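/- Let $N\ge 2$ and $S=\{1,\dots,N\}$. For each $\varepsilon>0$ let $X^\varepsilon_t$, $t\ge 0$, be a time-homogeneous continuous-time Markov chain on $S$ with right-continuous paths and transition rates $q_{ij}(\varepsilon)$, $i\ne j$, and let $\mathrm P_i$, $\mathrm E_i$ denote probability and expectation for the chain started at $i$. Assume that the family is asymptotically regular: $q_{ij}(\varepsilon)>0$ for all $\varepsilon>0$, $i\neq j$, and for all $i\ne j$, $k\neq l$ the limit $\lim_{\varepsilon\downarrow0} q_{ij}(\varepsilon)/q_{kl}(\varepsilon)\in[0,\infty]$ exists. The skeleton chain is the discrete-time chain on $S$ with transition probabilities $P_{ij}=\lim_{\varepsilon\downarrow 0} q_{ij}(\varepsilon)/\sum_{j'\ne i}q_{ij'}(\varepsilon)$ for $j\ne i$ and $P_{ii}=0$; assume that it has one ergodic class and no transient states, and let $\lambda$ be its invariant probability measure. Put $$T(i,\varepsilon)=\Big(\sum_{j\neq i}q_{ij}(\varepsilon)\Big)^{-1},\qquad \bar T(\varepsilon)=\sum_{i\in S}\lambda(i)\,T(i,\varepsilon).$$ Let $\mu(\cdot,\varepsilon)$ be the invariant probability measure of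 $X^\varepsilon_t$, and let $\alpha(j,t)$ be the proportion of time prior to $t$ that the process $X^\varepsilon$ spends in $j$. Let $t:(0,\infty)\to(0,\infty)$ satisfy $\bar T(\varepsilon)=o(t(\varepsilon))$ as $\varepsilon\downarrow 0$. Then the limits $\mu(j)=\lim_{\varepsilon\downarrow0}\mu(j,\varepsilon)$ exist, and for all $i,j\in S$ $$\lim_{\varepsilon\downarrow 0}\mathrm P_i\big(X^\varepsilon_{t(\varepsilon)}=j\big)=\mu(j),\qquad \mathrm E_i\,\alpha(j,t(\varepsilon))\sim\mu(j,\varepsilon)\quad\text{as }\varepsilon\downarrow0.$$ Moreover, for each $c>0$ there are $\delta(c)>0$ and $\varepsilon_0>0$ such that for all $\varepsilon\in(0,\varepsilon_0]$ and all $i,j\in S$ $$\mathrm P_i\big(\alpha(j,t(\varepsilon))<(1-c)\mu(j,\varepsilon)\big)\le e^{-\delta(c)\,t(\varepsilon)/\bar T(\varepsilon)},\qquad \mathrm P_i\big(\alpha(j,t(\varepsilon))>(1+c)\mu(j,\varepsilon)\big)\le e^{-\delta(c)\,t(\varepsilon)/\bar T(\varepsilon)}.$$ -/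

import Mathlib

open MeasureTheory Filter Topology Asymptotics
open scoped NNReal ENNReal

namespace MarkovFamily

noncomputable section

variable {N : ℕ}

/-- A time-homogeneous continuous-time Markov chain on `{0, …, N - 1}` with transition rates
`q i j` (`i ≠ j`; the diagonal of `q` plays no role), given as a Markov family: `P i` is the law
under which the process starts at `i`, and the process has right-continuous paths. -/
structure IsMarkovChain {Ω : Type*} [MeasurableSpace Ω] (q : Fin N → Fin N → ℝ)
    (P : Fin N → Measure Ω) (X : ℝ≥0 → Ω → Fin N) : Prop where
  isProbabilityMeasure : ∀ i, IsProbabilityMeasure (P i)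
  measurable : ∀ t, Measurable (X t)
  rightContinuous : ∀ ω t, ContinuousWithinAt (fun s => X s ω) (Set.Ici t) t
  start : ∀ i, P i {ω | X 0 ω = i} = 1
  /-- Given the past up to time `s` and `X s = j`, the state at time `s + t` has the law of
  `X t` under `P j`. -/
  markov : ∀ (i j k : Fin N) (s t : ℝ≥0) (A : Set Ω),
    MeasurableSet[⨆ u ≤ s, MeasurableSpace.comap (X u) inferInstance] A →
      P i (A ∩ {ω | X s ω = j} ∩ {ω | X (s + t) ω = k}) =
        P i (A ∩ {ω | X s ω = j}) * P j {ω | X t ω = k}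
  /-- `P i (X Δ = j) = q i j * Δ + o(Δ)` as `Δ ↓ 0`. -/
  rates : ∀ i j, i ≠ j →
    (fun Δ : ℝ≥0 => (P i).real {ω | X Δ ω = j} - q i j * (Δ : ℝ))
      =o[𝓝[>] 0] (fun Δ : ℝ≥0 => (Δ : ℝ))

/-- Total exit rate `∑_{j ≠ i} q i j` of the state `i`. -/
def exitRate (q : Fin N → Fin N → ℝ) (i : Fin N) : ℝ :=
  ∑ j ∈ Finset.univ.erase i, q i j

/-- Asymptotic regularity of a family of transition rates, as `ε ↓ 0`. -/
structure AsympRegular (q : ℝ → Fin N → Fin N → ℝ) : Prop where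
  pos : ∀ ε, 0 < ε → ∀ i j, i ≠ j → 0 < q ε i j
  ratio : ∀ i j k l, i ≠ j → k ≠ l →
    ∃ L : ℝ≥0∞, Tendsto (fun ε => ENNReal.ofReal (q ε i j / q ε k l)) (𝓝[>] 0) (𝓝 L)

/-- Transition matrix of the skeleton chain: the limits as `ε ↓ 0` of the jump probabilities. -/
def skeleton (q : ℝ → Fin N → Fin N → ℝ) : Matrix (Fin N) (Fin N) ℝ :=
  fun i j => if j = i then 0 else limUnder (𝓝[>] 0) (fun ε => q ε i j / exitRate (q ε) i)

/-- `j` can be reached from `i` (in some number of steps, possibly zero). -/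
def Reaches (P : Matrix (Fin N) (Fin N) ℝ) (i j : Fin N) : Prop := ∃ n : ℕ, 0 < (P ^ n) i j

/-- An ergodic class: the set of all states reachable from `i` is `C`, for each `i ∈ C`. -/
def IsErgodicClass (P : Matrix (Fin N) (Fin N) ℝ) (C : Set (Fin N)) : Prop :=
  C.Nonempty ∧ ∀ i ∈ C, ∀ j, Reaches P i j ↔ j ∈ C

/-- A transient state of a finite chain: some reachable state does not lead back. -/
def IsTransient (P : Matrix (Fin N) (Fin N) ℝ) (i : Fin N) : Prop :=
  ∃ j, Reaches P i j ∧ ¬ Reaches P j i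

/-- One ergodic class and no transient states. -/
def OneErgodicClass (P : Matrix (Fin N) (Fin N) ℝ) : Prop :=
  (∃! C, IsErgodicClass P C) ∧ ∀ i, ¬ IsTransient P i

/-- Probability vectors on the state space. -/
def IsProbVec (π : Fin N → ℝ) : Prop := (∀ i, 0 ≤ π i) ∧ ∑ i, π i = 1

/-- Invariant probability measures of the continuous-time chain with rates `q` (the flow into
each state equals the flow out of it). -/
def IsInvariantRates (q : Fin N → Fin N → ℝ) (π : Fin N → ℝ) : Prop :=
  IsProbVec π ∧ ∀ j, ∑ i ∈ Finset.univ.erase j, π i * q i j = π j * exitRate q j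

/-- Invariant probability measures of a discrete-time chain. -/
def IsInvariantMatrix (P : Matrix (Fin N) (Fin N) ℝ) (π : Fin N → ℝ) : Prop :=
  IsProbVec π ∧ ∀ j, ∑ i, π i * P i j = π j

/-- The invariant measure `μ(·, ε)` of the chain with rates `q ε` (unique when all the
off-diagonal rates are positive). -/
def invMeasure (q : ℝ → Fin N → Fin N → ℝ) (ε : ℝ) : Fin N → ℝ :=
  Classical.epsilon (IsInvariantRates (q ε))

/-- The invariant measure `λ` of the skeleton chain (unique when that chain has one ergodic
class). -/
def skeletonMeasure (q : ℝ → Fin N → Fin N → ℝ) : Fin N → ℝ :=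
  Classical.epsilon (IsInvariantMatrix (skeleton q))

/-- The limiting invariant measure `μ(i) = lim_{ε ↓ 0} μ(i, ε)`. -/
def limMeasure (q : ℝ → Fin N → Fin N → ℝ) (i : Fin N) : ℝ :=
  limUnder (𝓝[>] 0) (fun ε => invMeasure q ε i)

/-- `T(i, ε)`, the mean exit time from `i`. -/
def exitTime (q : ℝ → Fin N → Fin N → ℝ) (i : Fin N) (ε : ℝ) : ℝ := (exitRate (q ε) i)⁻¹

/-- `T̄(ε) = ∑ i, λ(i) T(i, ε)`. -/
def meanStepTime (q : ℝ → Fin N → Fin N → ℝ) (ε : ℝ) : ℝ :=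
  ∑ i, skeletonMeasure q i * exitTime q i ε

/-- `α(j, t)`: the proportion of time, prior to `t`, that the path `ω` spends in `j`. -/
def occupation {Ω : Type*} (X : ℝ≥0 → Ω → Fin N) (j : Fin N) (t : ℝ≥0) (ω : Ω) : ℝ :=
  (∫ s in (0 : ℝ)..t, Set.indicator {s : ℝ | X s.toNNReal ω = j} (fun _ => (1 : ℝ)) s) / t

end

end MarkovFamily

open MarkovFamily

namespace MarkovFamily

variable {N : ℕ}

/-! Everything rests on the Poisson equation `L f = 1_j - μ(j, ε)`, `f j = 0`, with `L` the
generator. Its solution is `μ(j, ε)` times the mean hitting time of `j`, and it satisfies `0 ≤ f ≤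
B` with `B = C μ(j, ε) T̄(ε)` and `C` independent of `ε`: the skeleton being irreducible, a path of
bounded length leads from any state to `j` along jumps of probability bounded below, and every mean
exit time is at most a constant times `T̄` (`exists_isPoissonSolution`,
`exists_eventually_isPoissonSolution`). The factor `μ(j, ε)` in `B` is what makes all later errors
relative to `μ(j, ε)`, even when this tends to `0`.

For `θ = η / B` with `η < 1`, the functions `1 ± θ f` are positive and close to constant. The
Feynman–Kac supermartingale bound (`lintegral_exp_integral_le`) applied to them controls exponential
moments of the occupation time. Linearising as `η ↓ 0` gives `|E α - μ| ≤ B / t = C μ T̄ / t`;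
Markov's inequality gives tails with exponent of order `c² μ t / B = c² t / (C T̄)`.

For the law at time `t`, take a state `j₀` whose mean exit time is at least `T̄`. The estimate of `E
α` makes the chain, from any start, sit in `j₀` with probability at least `μ(j₀, ε) / 2` at some
time of order `T̄`, and it then stays there for a time of order `T̄` with probability bounded below.
This is a Doeblin condition uniform in `ε` (`abs_transProb_sub_le_of_poisson`); periodicity of the
skeleton is harmless.

Finally, the invariant measure `ν` of the embedded jump chain converges to `λ` by compactness and
uniqueness, and `1 / μ(j, ε) = ∑ k, (ν k / ν j) (T k / T j)`, where every ratio has a limit in `[0,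
∞]` (`tendsto_invMeasure`). -/

/-! ### Riemann sums of right-continuous functions. -/

theorem tendsto_riemann_sum {ψ : ℝ → ℝ} (hψ : ∀ s, 0 ≤ s → ContinuousWithinAt ψ (Set.Ici s) s)
    {K : ℝ} (hK : ∀ s, |ψ s| ≤ K) {t : ℝ} (ht : 0 < t) :
    Tendsto (fun n : ℕ => ∑ k ∈ Finset.range (n + 1),
      ψ (((k : ℝ) + 1) * (t / ((n : ℝ) + 1))) * (t / ((n : ℝ) + 1))) atTop
      (𝓝 (∫ s in (0 : ℝ)..t, ψ s)) := by
  have hh : ∀ n : ℕ, 0 < t / ((n : ℝ) + 1) := fun n => by positivity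
  have hmeas : ∀ n : ℕ, Measurable
      (fun s : ℝ => ψ ((⌈s / (t / ((n : ℝ) + 1))⌉₊ : ℝ) * (t / ((n : ℝ) + 1)))) := by
    intro n
    have h1 : Measurable (fun s : ℝ => ⌈s / (t / ((n : ℝ) + 1))⌉₊) :=
      Nat.measurable_ceil.comp (measurable_id.div_const _)
    exact (measurable_from_nat (f := fun m : ℕ => ψ ((m : ℝ) * (t / ((n : ℝ) + 1))))).comp h1
  -- The sum is the integral of `ψ` sampled at `⌈s / h⌉ h`, with `h = t / (n + 1)`. This point lies
  -- in `[s, s + h]`, so it approaches `s` from the right, the side on which `ψ` is continuous;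
  -- dominated convergence concludes.
  have key : ∀ n : ℕ, ∑ k ∈ Finset.range (n + 1),
      ψ (((k : ℝ) + 1) * (t / ((n : ℝ) + 1))) * (t / ((n : ℝ) + 1))
      = ∫ s in (0 : ℝ)..t, ψ ((⌈s / (t / ((n : ℝ) + 1))⌉₊ : ℝ) * (t / ((n : ℝ) + 1))) := by
    intro n
    set h := t / ((n : ℝ) + 1) with hdef
    have hpos : 0 < h := hh n
    have hend : ((n + 1 : ℕ) : ℝ) * h = t := by
      rw [hdef]; push_cast; field_simp
    have := intervalIntegral.sum_integral_adjacent_intervals (μ := volume)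
      (f := fun s : ℝ => ψ ((⌈s / h⌉₊ : ℝ) * h)) (a := fun k : ℕ => (k : ℝ) * h) (n := n + 1)
      (fun k _ => by
        rw [intervalIntegrable_iff]
        refine Measure.integrableOn_of_bounded (M := K) (by simp) (hmeas n).aestronglyMeasurable ?_
        exact Eventually.of_forall fun s => by simpa using hK _)
    rw [hend] at this
    simp only [Nat.cast_zero, zero_mul] at this
    rw [← this]
    refine Finset.sum_congr rfl fun k _ => ?_
    have hle : (k : ℝ) * h ≤ ((k + 1 : ℕ) : ℝ) * h := by push_cast; nlinarith
    have hc : ∫ s in ((k : ℝ) * h)..(((k + 1 : ℕ) : ℝ) * h), ψ ((⌈s / h⌉₊ : ℝ) * h)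
        = ∫ s in ((k : ℝ) * h)..(((k + 1 : ℕ) : ℝ) * h), ψ (((k : ℝ) + 1) * h) := by
      rw [intervalIntegral.integral_of_le hle, intervalIntegral.integral_of_le hle]
      refine setIntegral_congr_fun measurableSet_Ioc fun s hs => ?_
      have : ⌈s / h⌉₊ = k + 1 := by
        rw [Nat.ceil_eq_iff (by omega)]
        constructor
        · rw [lt_div_iff₀ hpos]; simpa using hs.1
        · rw [div_le_iff₀ hpos]; exact hs.2
      simp [this]
    rw [hc, intervalIntegral.integral_const]
    push_cast
    rw [smul_eq_mul]; ring
  simp_rw [key]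
  refine intervalIntegral.tendsto_integral_filter_of_dominated_convergence (fun _ => K)
    (Eventually.of_forall fun n => (hmeas n).aestronglyMeasurable)
    (Eventually.of_forall fun n => Eventually.of_forall fun s _ => by simpa using hK _)
    intervalIntegrable_const (Eventually.of_forall fun s hs => ?_)
  rw [Set.uIoc_of_le ht.le] at hs
  refine (hψ s hs.1.le).tendsto.comp (tendsto_nhdsWithin_iff.2 ⟨?_, Eventually.of_forall fun n => ?_⟩)
  · have hlim : Tendsto (fun n : ℕ => s + t / ((n : ℝ) + 1)) atTop (𝓝 s) := by
      simpa using (tendsto_const_nhds (x := s)).add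
        ((tendsto_const_nhds (x := t)).div_atTop
          (tendsto_atTop_add_const_right atTop (1 : ℝ) tendsto_natCast_atTop_atTop))
    refine tendsto_of_tendsto_of_tendsto_of_le_of_le tendsto_const_nhds hlim (fun n => ?_)
      (fun n => ?_)
    · have := Nat.le_ceil (s / (t / ((n : ℝ) + 1)))
      rwa [div_le_iff₀ (hh n)] at this
    · have := (Nat.ceil_lt_add_one (a := s / (t / ((n : ℝ) + 1)))
        (div_nonneg hs.1.le (hh n).le)).le
      calc (⌈s / (t / ((n : ℝ) + 1))⌉₊ : ℝ) * (t / ((n : ℝ) + 1))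
          ≤ (s / (t / ((n : ℝ) + 1)) + 1) * (t / ((n : ℝ) + 1)) :=
            mul_le_mul_of_nonneg_right this (hh n).le
        _ = s + t / ((n : ℝ) + 1) := by
            rw [add_mul, div_mul_cancel₀ _ (hh n).ne', one_mul]
  · have := Nat.le_ceil (s / (t / ((n : ℝ) + 1)))
    rw [div_le_iff₀ (hh n)] at this
    exact this

/-! ### Transition probabilities and the Feynman–Kac bound. -/

/-- The generator of the chain with rates `q`, acting on functions. -/
noncomputable def generator (q : Fin N → Fin N → ℝ) (g : Fin N → ℝ) (i : Fin N) : ℝ :=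
  ∑ j ∈ Finset.univ.erase i, q i j * (g j - g i)

/-- The transition probability from `i` to `j` in time `t`. -/
noncomputable def transProb {Ω : Type*} [MeasurableSpace Ω] (P : Fin N → Measure Ω)
    (X : ℝ≥0 → Ω → Fin N) (t : ℝ≥0) (i j : Fin N) : ℝ := (P i).real {ω | X t ω = j}

namespace IsMarkovChain

variable {Ω : Type*} [MeasurableSpace Ω] {q : Fin N → Fin N → ℝ} {P : Fin N → Measure Ω}
  {X : ℝ≥0 → Ω → Fin N}

theorem measurableSet_state (hX : IsMarkovChain q P X) (t : ℝ≥0) (j : Fin N) :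
    MeasurableSet {ω | X t ω = j} := hX.measurable t (measurableSet_singleton j)

theorem sum_transProb (hX : IsMarkovChain q P X) (t : ℝ≥0) (i : Fin N) :
    ∑ j, transProb P X t i j = 1 := by
  have := hX.isProbabilityMeasure i
  have h := measureReal_biUnion_finset (μ := P i) (s := Finset.univ)
    (f := fun j => {ω | X t ω = j})
    (fun a _ b _ hab => Set.disjoint_left.2 fun ω h1 h2 => hab (h1.symm.trans h2))
    (fun j _ => hX.measurableSet_state t j)
  unfold transProb
  rw [← h]
  have : (⋃ j ∈ (Finset.univ : Finset (Fin N)), {ω | X t ω = j}) = Set.univ := by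
    ext ω; simp
  rw [this]; simp

theorem transProb_nonneg (P : Fin N → Measure Ω) (X : ℝ≥0 → Ω → Fin N) (t : ℝ≥0) (i j : Fin N) :
    0 ≤ transProb P X t i j := measureReal_nonneg

theorem transProb_le_one (hX : IsMarkovChain q P X) (t : ℝ≥0) (i j : Fin N) :
    transProb P X t i j ≤ 1 := by
  have := hX.isProbabilityMeasure i
  exact measureReal_le_one

theorem transProb_zero_self (hX : IsMarkovChain q P X) (i : Fin N) :
    transProb P X 0 i i = 1 := by
  simp [transProb, measureReal_def, hX.start i]

/-- The Chapman–Kolmogorov equations. -/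
theorem transProb_add (hX : IsMarkovChain q P X) (s t : ℝ≥0) (i k : Fin N) :
    transProb P X (s + t) i k = ∑ j, transProb P X s i j * transProb P X t j k := by
  have := hX.isProbabilityMeasure i
  have h := measureReal_biUnion_finset (μ := P i) (s := Finset.univ)
    (f := fun j => {ω | X s ω = j} ∩ {ω | X (s + t) ω = k})
    (fun a _ b _ hab => Set.disjoint_left.2 fun ω h1 h2 => hab (h1.1.symm.trans h2.1))
    (fun j _ => (hX.measurableSet_state s j).inter (hX.measurableSet_state (s + t) k))
  have hU : (⋃ j ∈ (Finset.univ : Finset (Fin N)), {ω | X s ω = j} ∩ {ω | X (s + t) ω = k})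
      = {ω | X (s + t) ω = k} := by
    ext ω; simp
  rw [hU] at h
  unfold transProb
  rw [h]
  refine Finset.sum_congr rfl fun j _ => ?_
  have := hX.markov i j k s t Set.univ MeasurableSet.univ
  simp only [Set.univ_inter] at this
  simp only [measureReal_def, this, ENNReal.toReal_mul]

theorem tendsto_transProb_div (hX : IsMarkovChain q P X) {i j : Fin N} (hij : i ≠ j) :
    Tendsto (fun h : ℝ≥0 => transProb P X h i j / (h : ℝ)) (𝓝[>] 0) (𝓝 (q i j)) := by
  have h1 := (hX.rates i j hij).tendsto_div_nhds_zero
  have h2 := h1.add_const (q i j)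
  rw [zero_add] at h2
  refine h2.congr' ?_
  filter_upwards [self_mem_nhdsWithin] with h hh
  have : (h : ℝ) ≠ 0 := by
    have : (0 : ℝ≥0) < h := hh
    exact_mod_cast this.ne'
  simp only [transProb]
  field_simp
  ring

theorem tendsto_coe_nhdsGT_zero : Tendsto (fun h : ℝ≥0 => (h : ℝ)) (𝓝[>] 0) (𝓝[>] 0) := by
  refine tendsto_nhdsWithin_iff.2 ⟨?_, ?_⟩
  · have : Tendsto (fun h : ℝ≥0 => (h : ℝ)) (𝓝 0) (𝓝 ((0 : ℝ≥0) : ℝ)) :=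
      NNReal.continuous_coe.tendsto 0
    simpa using this.mono_left nhdsWithin_le_nhds
  · filter_upwards [self_mem_nhdsWithin] with h hh
    exact_mod_cast (hh : (0 : ℝ≥0) < h)

/-- Derivative at time `0` of the Feynman–Kac operator. -/
theorem tendsto_weighted_transProb (hX : IsMarkovChain q P X) (V u : Fin N → ℝ) (i : Fin N) :
    Tendsto (fun h : ℝ≥0 => (∑ j, transProb P X h i j * (Real.exp (h * V j) * u j) - u i) / (h : ℝ))
      (𝓝[>] 0) (𝓝 (generator q u i + V i * u i)) := by
  have hexp : ∀ v : ℝ, Tendsto (fun h : ℝ≥0 => Real.exp (h * v)) (𝓝[>] 0) (𝓝 1) := by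
    intro v
    have : Tendsto (fun x : ℝ => Real.exp (x * v)) (𝓝[>] 0) (𝓝 1) := by
      have : Tendsto (fun x : ℝ => Real.exp (x * v)) (𝓝 0) (𝓝 (Real.exp (0 * v))) :=
        (by fun_prop : Continuous fun x : ℝ => Real.exp (x * v)).tendsto 0
      rw [zero_mul, Real.exp_zero] at this
      exact this.mono_left nhdsWithin_le_nhds
    exact this.comp tendsto_coe_nhdsGT_zero
  have hder : Tendsto (fun h : ℝ≥0 => (Real.exp (h * V i) - 1) / (h : ℝ)) (𝓝[>] 0) (𝓝 (V i)) := by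
    have hd : HasDerivAt (fun x : ℝ => Real.exp (x * V i)) (V i) 0 := by
      have := ((hasDerivAt_id (0 : ℝ)).mul_const (V i)).exp
      simpa using this
    have := hd.tendsto_slope_zero_right.comp tendsto_coe_nhdsGT_zero
    refine this.congr fun h => ?_
    simp [div_eq_inv_mul]
  -- Since row `i` sums to `1`, the diagonal probability can be eliminated: the numerator is `(exp
  -- (h V i) - 1) u i` plus the sum over `j ≠ i` of `p i j` times `exp (h V j) u j - exp (h V i) u
  -- i`.
  have hsum := (hder.mul_const (u i)).add (tendsto_finsetSum (Finset.univ.erase i) (fun j hj =>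
    (hX.tendsto_transProb_div (Finset.ne_of_mem_erase hj).symm).mul
      (((hexp (V j)).mul_const (u j)).sub ((hexp (V i)).mul_const (u i)))))
  have hlim : V i * u i + ∑ j ∈ Finset.univ.erase i, q i j * (1 * u j - 1 * u i)
      = generator q u i + V i * u i := by
    simp [generator, add_comm]
  rw [hlim] at hsum
  refine hsum.congr fun h => ?_
  have hs := hX.sum_transProb h i
  rw [← Finset.add_sum_erase _ _ (Finset.mem_univ i)] at hs
  rw [← Finset.add_sum_erase _ _ (Finset.mem_univ i)]
  have hp : transProb P X h i i = 1 - ∑ j ∈ Finset.univ.erase i, transProb P X h i j := by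
    linarith
  rw [hp]
  have : ∀ j, transProb P X h i j / (h : ℝ) * (Real.exp (h * V j) * u j - Real.exp (h * V i) * u i)
      = (transProb P X h i j * (Real.exp (h * V j) * u j)
        - transProb P X h i j * (Real.exp (h * V i) * u i)) / h := fun j => by ring
  simp_rw [this]
  rw [← Finset.sum_div, Finset.sum_sub_distrib, ← Finset.sum_mul]
  ring

/-- The Markov property for nonnegative functionals of the past. -/
theorem lintegral_markov (hX : IsMarkovChain q P X) (i j k : Fin N) (s t : ℝ≥0) {Φ : Ω → ℝ≥0∞}
    (hΦ : Measurable[⨆ u ≤ s, MeasurableSpace.comap (X u) inferInstance] Φ) :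
    ∫⁻ ω in {ω | X s ω = j} ∩ {ω | X (s + t) ω = k}, Φ ω ∂P i
      = (∫⁻ ω in {ω | X s ω = j}, Φ ω ∂P i) * P j {ω | X t ω = k} := by
  have hm : (⨆ u ≤ s, MeasurableSpace.comap (X u) inferInstance) ≤ ‹MeasurableSpace Ω› :=
    iSup₂_le fun u _ => (hX.measurable u).comap_le
  -- Trimmed to the past, the two restricted measures are proportional by the Markov property on
  -- sets, so integrals of past-measurable functions are proportional too.
  rw [← lintegral_trim hm hΦ, mul_comm, ← smul_eq_mul, ← lintegral_smul_measure,
    ← lintegral_trim hm hΦ]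
  congr 1
  refine @Measure.ext _ (_) _ _ fun A hA => ?_
  rw [trim_measurableSet_eq hm hA, trim_measurableSet_eq hm hA, Measure.smul_apply,
    Measure.restrict_apply (hm A hA), Measure.restrict_apply (hm A hA), ← Set.inter_assoc,
    hX.markov i j k s t A hA, smul_eq_mul, mul_comm]

theorem lintegral_eq_sum_state (hX : IsMarkovChain q P X) (i : Fin N) (s : ℝ≥0) (Φ : Ω → ℝ≥0∞)
    (A : Set Ω) (hA : MeasurableSet A) :
    ∫⁻ ω in A, Φ ω ∂P i = ∑ j, ∫⁻ ω in A ∩ {ω | X s ω = j}, Φ ω ∂P i := by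
  have hU : A = ⋃ j ∈ (Finset.univ : Finset (Fin N)), A ∩ {ω | X s ω = j} := by
    ext ω; simp
  conv_lhs => rw [hU]
  refine lintegral_biUnion_finset ?_ (fun j _ => hA.inter (hX.measurableSet_state s j)) _
  exact fun a _ b _ hab => Set.disjoint_left.2 fun ω h1 h2 => hab (h1.2.symm.trans h2.2)

/-- Discrete-time Feynman–Kac bound along the time grid of step `h`. -/
theorem lintegral_prod_le (hX : IsMarkovChain q P X) (h : ℝ≥0) (W U : Fin N → ℝ≥0∞) (ρ : ℝ≥0∞)
    (hρ : ∀ j, ∑ k, P j {ω | X h ω = k} * (W k * U k) ≤ ρ * U j) (i : Fin N) (n : ℕ) :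
    ∫⁻ ω, (∏ k ∈ Finset.range n, W (X (((k : ℝ≥0) + 1) * h) ω)) * U (X ((n : ℝ≥0) * h) ω) ∂P i
      ≤ ρ ^ n * U i := by
  have hprob := hX.isProbabilityMeasure i
  induction n with
  | zero =>
    have hae : ∀ᵐ ω ∂P i, X 0 ω = i := by
      rw [ae_iff]
      exact (prob_compl_eq_zero_iff (hX.measurableSet_state 0 i)).2 (hX.start i)
    simp only [Finset.range_zero, Finset.prod_empty, one_mul, Nat.cast_zero, zero_mul, pow_zero]
    rw [lintegral_congr_ae (g := fun _ => U i) (hae.mono fun ω hω => by simp only [hω])]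
    simp
  | succ n ih =>
    set Φ : Ω → ℝ≥0∞ := fun ω => ∏ k ∈ Finset.range n, W (X (((k : ℝ≥0) + 1) * h) ω) with hΦdef
    set s : ℝ≥0 := (n : ℝ≥0) * h with hs
    have hΦ : Measurable[⨆ u ≤ s, MeasurableSpace.comap (X u) inferInstance] Φ := by
      refine Finset.measurable_fun_prod _ fun k hk => ?_
      have hle : ((k : ℝ≥0) + 1) * h ≤ s := by
        rw [hs]
        gcongr
        have := Finset.mem_range.1 hk
        exact_mod_cast this
      have h1 : Measurable[MeasurableSpace.comap (X (((k : ℝ≥0) + 1) * h)) inferInstance]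
          (X (((k : ℝ≥0) + 1) * h)) := comap_measurable _
      have h2 := (measurable_of_countable W).comp h1
      exact h2.mono (le_iSup₂_of_le (f := fun u (_ : u ≤ s) =>
        MeasurableSpace.comap (X u) inferInstance) _ hle le_rfl) le_rfl
    have hstep : ((n + 1 : ℕ) : ℝ≥0) * h = s + h := by rw [hs]; push_cast; ring
    have hstep' : ((n : ℝ≥0) + 1) * h = s + h := by rw [hs]; ring
    have hΦ0 : Measurable Φ := hΦ.mono (iSup₂_le fun u _ => (hX.measurable u).comap_le) le_rfl
    simp only [Finset.prod_range_succ, hstep, hstep']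
    calc ∫⁻ ω, Φ ω * W (X (s + h) ω) * U (X (s + h) ω) ∂P i
        = ∑ j, ∑ k, ∫⁻ ω in {ω | X s ω = j} ∩ {ω | X (s + h) ω = k},
            Φ ω * W (X (s + h) ω) * U (X (s + h) ω) ∂P i := by
          rw [← setLIntegral_univ, hX.lintegral_eq_sum_state i s _ _ MeasurableSet.univ]
          refine Finset.sum_congr rfl fun j _ => ?_
          rw [Set.univ_inter, hX.lintegral_eq_sum_state i (s + h) _ _ (hX.measurableSet_state s j)]
      _ = ∑ j, ∑ k, (∫⁻ ω in {ω | X s ω = j}, Φ ω ∂P i) * (P j {ω | X h ω = k} * (W k * U k)) := by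
          refine Finset.sum_congr rfl fun j _ => Finset.sum_congr rfl fun k _ => ?_
          rw [← mul_assoc, ← hX.lintegral_markov i j k s h hΦ, ← lintegral_mul_const _ hΦ0]
          refine setLIntegral_congr_fun
            ((hX.measurableSet_state s j).inter (hX.measurableSet_state _ k)) fun ω hω => ?_
          have : X (s + h) ω = k := hω.2
          simp only [this, mul_assoc]
      _ ≤ ∑ j, (∫⁻ ω in {ω | X s ω = j}, Φ ω ∂P i) * (ρ * U j) := by
          refine Finset.sum_le_sum fun j _ => ?_
          rw [← Finset.mul_sum]
          gcongr
          exact hρ j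
      _ = ρ * ∑ j, ∫⁻ ω in {ω | X s ω = j}, Φ ω * U (X s ω) ∂P i := by
          rw [Finset.mul_sum]
          refine Finset.sum_congr rfl fun j _ => ?_
          rw [mul_left_comm, ← lintegral_mul_const _ hΦ0]
          congr 1
          refine setLIntegral_congr_fun (hX.measurableSet_state s j) fun ω hω => ?_
          have : X s ω = j := hω
          simp only [this]
      _ = ρ * ∫⁻ ω, Φ ω * U (X s ω) ∂P i := by
          rw [← setLIntegral_univ (μ := P i), hX.lintegral_eq_sum_state i s _ _ MeasurableSet.univ]
          simp
      _ ≤ ρ ^ (n + 1) * U i := by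
          rw [pow_succ', mul_assoc]
          gcongr

theorem tendsto_riemann_sum_path (hX : IsMarkovChain q P X) (V : Fin N → ℝ) (ω : Ω) {t : ℝ≥0}
    (ht : 0 < t) :
    Tendsto (fun n : ℕ => ∑ k ∈ Finset.range (n + 1),
      V (X (((k : ℝ≥0) + 1) * (t / ((n : ℝ≥0) + 1))) ω) * ((t : ℝ) / ((n : ℝ) + 1))) atTop
      (𝓝 (∫ s in (0 : ℝ)..t, V (X s.toNNReal ω))) := by
  have hcont : ∀ s : ℝ, 0 ≤ s →
      ContinuousWithinAt (fun s : ℝ => V (X s.toNNReal ω)) (Set.Ici s) s := by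
    intro s _
    have h1 : ContinuousWithinAt (fun r : ℝ≥0 => V (X r ω)) (Set.Ici s.toNNReal) s.toNNReal :=
      (continuous_of_discreteTopology (f := V)).continuousAt.comp_continuousWithinAt
        (hX.rightContinuous ω s.toNNReal)
    exact h1.comp (f := Real.toNNReal) continuous_real_toNNReal.continuousWithinAt
      fun r hr => Real.toNNReal_le_toNNReal hr
  have hb : ∀ s : ℝ, |V (X s.toNNReal ω)| ≤ ∑ i, |V i| := fun s =>
    Finset.single_le_sum (f := fun i => |V i|) (fun i _ => abs_nonneg _) (Finset.mem_univ _)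
  refine (tendsto_riemann_sum hcont hb (t := t) (by exact_mod_cast ht)).congr fun n => ?_
  refine Finset.sum_congr rfl fun k _ => ?_
  have : (((k : ℝ) + 1) * ((t : ℝ) / ((n : ℝ) + 1))).toNNReal
      = ((k : ℝ≥0) + 1) * (t / ((n : ℝ≥0) + 1)) := by
    rw [← Real.toNNReal_coe (r := ((k : ℝ≥0) + 1) * (t / ((n : ℝ≥0) + 1)))]
    push_cast
    rfl
  rw [this]

theorem measurable_integral_path (hX : IsMarkovChain q P X) (V : Fin N → ℝ) {t : ℝ≥0}
    (ht : 0 < t) : Measurable fun ω => ∫ s in (0 : ℝ)..t, V (X s.toNNReal ω) := by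
  refine measurable_of_tendsto_metrizable (f := fun (n : ℕ) ω => ∑ k ∈ Finset.range (n + 1),
      V (X (((k : ℝ≥0) + 1) * (t / ((n : ℝ≥0) + 1))) ω) * ((t : ℝ) / ((n : ℝ) + 1)))
    (fun n => ?_) (tendsto_pi_nhds.2 fun ω => hX.tendsto_riemann_sum_path V ω ht)
  refine Finset.measurable_fun_sum _ fun k _ => ?_
  exact ((measurable_of_countable V).comp (hX.measurable _)).mul_const _

theorem tendsto_step {t : ℝ≥0} (ht : 0 < t) :
    Tendsto (fun n : ℕ => t / ((n : ℝ≥0) + 1)) atTop (𝓝[>] 0) := by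
  refine tendsto_nhdsWithin_iff.2 ⟨?_, Eventually.of_forall fun n => ?_⟩
  · rw [← NNReal.tendsto_coe]
    push_cast
    exact (tendsto_const_nhds (x := (t : ℝ))).div_atTop
          (tendsto_atTop_add_const_right atTop (1 : ℝ) tendsto_natCast_atTop_atTop)
  · exact div_pos ht (by positivity)

/-- One-step hypothesis of `lintegral_prod_le` for small steps. The derivative at `0` is only known
to be nonpositive, so a slack `γ > 0` is needed to turn it into an inequality valid for small `h`;
over time `t` the slack costs `exp (γ t)`. -/
theorem lintegral_prod_exp_le (hX : IsMarkovChain q P X) {V u : Fin N → ℝ} (hu : ∀ i, 0 < u i)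
    (hV : ∀ i, generator q u i + V i * u i ≤ 0) {γ : ℝ} (hγ : 0 < γ) :
    ∀ᶠ h : ℝ≥0 in 𝓝[>] 0, ∀ j, ∑ k, P j {ω | X h ω = k} *
      (ENNReal.ofReal (Real.exp (h * V k)) * ENNReal.ofReal (u k))
        ≤ ENNReal.ofReal (Real.exp (γ * h)) * ENNReal.ofReal (u j) := by
  refine eventually_all.2 fun j => ?_
  have hlt : generator q u j + V j * u j < γ * u j := (hV j).trans_lt (mul_pos hγ (hu j))
  filter_upwards [(hX.tendsto_weighted_transProb V u j).eventually_lt_const hlt,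
    self_mem_nhdsWithin] with h h1 h2
  have hprob := hX.isProbabilityMeasure j
  have hpos : (0 : ℝ) < h := by exact_mod_cast (h2 : (0 : ℝ≥0) < h)
  rw [div_lt_iff₀ hpos] at h1
  have hle : ∑ k, transProb P X h j k * (Real.exp (h * V k) * u k) ≤ Real.exp (γ * h) * u j := by
    have := Real.add_one_le_exp (γ * h)
    nlinarith [hu j]
  have hterm : ∀ k, P j {ω | X h ω = k} *
      (ENNReal.ofReal (Real.exp (h * V k)) * ENNReal.ofReal (u k))
      = ENNReal.ofReal (transProb P X h j k * (Real.exp (h * V k) * u k)) := by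
    intro k
    rw [ENNReal.ofReal_mul (transProb_nonneg P X h j k), ENNReal.ofReal_mul (Real.exp_pos _).le,
      transProb, ofReal_measureReal]
  simp_rw [hterm]
  rw [← ENNReal.ofReal_sum_of_nonneg, ← ENNReal.ofReal_mul (Real.exp_pos _).le]
  · exact ENNReal.ofReal_le_ofReal hle
  · exact fun k _ => mul_nonneg (transProb_nonneg P X h j k)
      (mul_nonneg (Real.exp_pos _).le (hu k).le)

/-- Feynman–Kac bound: `exp (∫ V) u` is a supermartingale if `generator q u + V u ≤ 0`. -/
theorem lintegral_exp_integral_le (hX : IsMarkovChain q P X) {V u : Fin N → ℝ} (hu : ∀ i, 0 < u i)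
    (hV : ∀ i, generator q u i + V i * u i ≤ 0) {t : ℝ≥0} (ht : 0 < t) (i : Fin N) :
    ∫⁻ ω, ENNReal.ofReal (Real.exp (∫ s in (0 : ℝ)..t, V (X s.toNNReal ω)) * u (X t ω)) ∂P i
      ≤ ENNReal.ofReal (u i) := by
  -- The discrete bound passes to the limit by Fatou's lemma, and the slack is removed by `γ ↓ 0`.
  have key : ∀ γ : ℝ, 0 < γ →
      ∫⁻ ω, ENNReal.ofReal (Real.exp (∫ s in (0 : ℝ)..t, V (X s.toNNReal ω)) * u (X t ω)) ∂P i
      ≤ ENNReal.ofReal (Real.exp (γ * t) * u i) := by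
    intro γ hγ
    set F : ℕ → Ω → ℝ≥0∞ := fun n ω => ENNReal.ofReal (Real.exp (∑ k ∈ Finset.range (n + 1),
      V (X (((k : ℝ≥0) + 1) * (t / ((n : ℝ≥0) + 1))) ω) * ((t : ℝ) / ((n : ℝ) + 1)))
        * u (X t ω)) with hF
    have hFm : ∀ n, Measurable (F n) := by
      intro n
      refine ENNReal.measurable_ofReal.comp (Measurable.mul (Real.measurable_exp.comp
        (Finset.measurable_fun_sum _ fun k _ => ?_))
        ((measurable_of_countable u).comp (hX.measurable _)))
      exact ((measurable_of_countable V).comp (hX.measurable _)).mul_const _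
    have hlim : ∀ ω, Tendsto (fun n => F n ω) atTop (𝓝 (ENNReal.ofReal
        (Real.exp (∫ s in (0 : ℝ)..t, V (X s.toNNReal ω)) * u (X t ω)))) := fun ω =>
      ENNReal.tendsto_ofReal (((Real.continuous_exp.tendsto _).comp
        (hX.tendsto_riemann_sum_path V ω ht)).mul_const _)
    have hbound : ∀ᶠ n in atTop, ∫⁻ ω, F n ω ∂P i ≤ ENNReal.ofReal (Real.exp (γ * t) * u i) := by
      filter_upwards [(tendsto_step ht).eventually (hX.lintegral_prod_exp_le hu hV hγ)] with n hn
      have h1 := hX.lintegral_prod_le (t / ((n : ℝ≥0) + 1)) _ (fun k => ENNReal.ofReal (u k)) _ hn i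
        (n + 1)
      have hend : ((n + 1 : ℕ) : ℝ≥0) * (t / ((n : ℝ≥0) + 1)) = t := by
        push_cast; field_simp
      have hend' : ((n + 1 : ℕ) : ℝ) * (γ * (t / ((n : ℝ≥0) + 1) : ℝ≥0)) = γ * t := by
        push_cast; field_simp
      rw [hend, ← ENNReal.ofReal_pow (Real.exp_pos _).le, ← Real.exp_nat_mul, hend',
        ← ENNReal.ofReal_mul (Real.exp_pos _).le] at h1
      refine le_trans (le_of_eq (lintegral_congr fun ω => ?_)) h1
      rw [hF]
      simp only
      rw [ENNReal.ofReal_mul (Real.exp_pos _).le, Real.exp_sum,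
        ENNReal.ofReal_prod_of_nonneg (fun _ _ => (Real.exp_pos _).le)]
      push_cast
      simp_rw [mul_comm (V _)]
    calc _ = ∫⁻ ω, liminf (fun n => F n ω) atTop ∂P i := by
          refine lintegral_congr fun ω => (hlim ω).liminf_eq.symm
      _ ≤ liminf (fun n => ∫⁻ ω, F n ω ∂P i) atTop := lintegral_liminf_le hFm
      _ ≤ _ := by
          refine liminf_le_of_frequently_le' hbound.frequently
  have hlim : Tendsto (fun γ : ℝ => ENNReal.ofReal (Real.exp (γ * t) * u i)) (𝓝[>] 0)
      (𝓝 (ENNReal.ofReal (u i))) := by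
    have : Tendsto (fun γ : ℝ => Real.exp (γ * t) * u i) (𝓝 0) (𝓝 (Real.exp (0 * t) * u i)) :=
      (by fun_prop : Continuous fun γ : ℝ => Real.exp (γ * t) * u i).tendsto 0
    rw [zero_mul, Real.exp_zero, one_mul] at this
    exact ENNReal.tendsto_ofReal (this.mono_left nhdsWithin_le_nhds)
  exact ge_of_tendsto hlim (eventually_mem_nhdsWithin.mono fun γ hγ => key γ hγ)

end IsMarkovChain

/-! ### Poisson equation and exponential moments of occupation times. -/

/-- `f` is a solution, vanishing at `j` and with values in `[0, B]`, of the Poisson equation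
`generator q f = 1_j - m`. -/
structure IsPoissonSolution (q : Fin N → Fin N → ℝ) (j : Fin N) (m B : ℝ) (f : Fin N → ℝ) :
    Prop where
  nonneg : ∀ i, 0 ≤ f i
  le : ∀ i, f i ≤ B
  self : f j = 0
  eq : ∀ i, generator q f i = (if i = j then 1 else 0) - m

theorem generator_const_add_mul (q : Fin N → Fin N → ℝ) (a b : ℝ) (f : Fin N → ℝ) (i : Fin N) :
    generator q (fun k => a + b * f k) i = b * generator q f i := by
  unfold generator
  rw [Finset.mul_sum]
  exact Finset.sum_congr rfl fun j _ => by ring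

theorem occupation_eq {Ω : Type*} (X : ℝ≥0 → Ω → Fin N) (j : Fin N) (t : ℝ≥0) (ω : Ω) :
    occupation X j t ω
      = (∫ s in (0 : ℝ)..t, (fun k => if k = j then (1 : ℝ) else 0) (X s.toNNReal ω)) / t := by
  simp [occupation, Set.indicator_apply]

theorem occupation_nonneg {Ω : Type*} (X : ℝ≥0 → Ω → Fin N) (j : Fin N) (t : ℝ≥0) (ω : Ω) :
    0 ≤ occupation X j t ω := by
  refine div_nonneg (intervalIntegral.integral_nonneg t.2 fun s _ => ?_) t.2
  exact Set.indicator_nonneg (fun _ _ => zero_le_one) _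

theorem occupation_le_one {Ω : Type*} (X : ℝ≥0 → Ω → Fin N) (j : Fin N) (t : ℝ≥0) (ω : Ω) :
    occupation X j t ω ≤ 1 := by
  refine div_le_one_of_le₀ ?_ t.2
  have := intervalIntegral.norm_integral_le_of_norm_le_const (a := (0 : ℝ)) (b := t) (C := 1)
    (f := Set.indicator {s : ℝ | X s.toNNReal ω = j} (fun _ => (1 : ℝ))) (fun s _ => by
      by_cases h : s ∈ {s : ℝ | X s.toNNReal ω = j} <;> simp [Set.indicator, h])
  rw [sub_zero, one_mul, abs_of_nonneg t.coe_nonneg, Real.norm_eq_abs] at this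
  exact (le_abs_self _).trans this

namespace IsMarkovChain

variable {Ω : Type*} [MeasurableSpace Ω] {q : Fin N → Fin N → ℝ} {P : Fin N → Measure Ω}
  {X : ℝ≥0 → Ω → Fin N}

theorem integral_affine_path (hX : IsMarkovChain q P X) (j : Fin N) (a b : ℝ) {t : ℝ≥0}
    (ht : 0 < t) (ω : Ω) :
    ∫ s in (0 : ℝ)..t, (fun k => a * (if k = j then (1 : ℝ) else 0) + b) (X s.toNNReal ω)
      = (a * occupation X j t ω + b) * t := by
  have ht' : (t : ℝ) ≠ 0 := by exact_mod_cast ht.ne'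
  have h1 := hX.tendsto_riemann_sum_path
    (fun k => a * (if k = j then (1 : ℝ) else 0) + b) ω ht
  have h2 := ((hX.tendsto_riemann_sum_path
    (fun k => (if k = j then (1 : ℝ) else 0)) ω ht).const_mul a).add_const (b * t)
  have h3 : a * (∫ s in (0 : ℝ)..t, (fun k => if k = j then (1 : ℝ) else 0) (X s.toNNReal ω))
      + b * t = (a * occupation X j t ω + b) * t := by
    rw [occupation_eq]; field_simp
  rw [h3] at h2
  refine tendsto_nhds_unique h1 (h2.congr fun n => ?_)
  simp only [add_mul, Finset.sum_add_distrib, Finset.mul_sum, Finset.sum_const, Finset.card_range,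
    nsmul_eq_mul, Nat.cast_add, Nat.cast_one]
  congr 1
  · exact Finset.sum_congr rfl fun k _ => by ring
  · field_simp

theorem measurable_occupation (hX : IsMarkovChain q P X) (j : Fin N) {t : ℝ≥0} (ht : 0 < t) :
    Measurable (occupation X j t) := by
  rw [funext (occupation_eq X j t)]
  exact (hX.measurable_integral_path (fun k => if k = j then (1 : ℝ) else 0) ht).div_const _

theorem integrable_occupation (hX : IsMarkovChain q P X) (i j : Fin N) {t : ℝ≥0} (ht : 0 < t) :
    Integrable (occupation X j t) (P i) := by
  have := hX.isProbabilityMeasure i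
  refine Integrable.of_bound (hX.measurable_occupation j ht).aestronglyMeasurable 1
    (Eventually.of_forall fun ω => ?_)
  rw [Real.norm_eq_abs, abs_of_nonneg (occupation_nonneg X j t ω)]
  exact occupation_le_one X j t ω

theorem integrable_exp_occupation (hX : IsMarkovChain q P X) (i j : Fin N) (a b : ℝ) {t : ℝ≥0}
    (ht : 0 < t) : Integrable (fun ω => Real.exp ((a * occupation X j t ω + b) * t)) (P i) := by
  have := hX.isProbabilityMeasure i
  refine Integrable.of_bound (C := Real.exp ((|a| + |b|) * t)) (Measurable.aestronglyMeasurable ?_)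
    (Eventually.of_forall fun ω => ?_)
  · exact Real.measurable_exp.comp
      ((((hX.measurable_occupation j ht).const_mul a).add_const b).mul_const _)
  · rw [Real.norm_eq_abs, abs_of_pos (Real.exp_pos _)]
    have h0 := occupation_nonneg X j t ω
    have h1 := occupation_le_one X j t ω
    have ht0 : (0 : ℝ) ≤ t := t.2
    gcongr
    · calc a * occupation X j t ω ≤ |a| * occupation X j t ω := by gcongr; exact le_abs_self a
        _ ≤ |a| := mul_le_of_le_one_right (abs_nonneg a) h1
    · exact le_abs_self b

theorem integral_exp_occupation_le (hX : IsMarkovChain q P X) (j : Fin N) (a b : ℝ)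
    {u : Fin N → ℝ} {lo hi : ℝ} (hlo : 0 < lo) (hulo : ∀ i, lo ≤ u i) (huhi : ∀ i, u i ≤ hi)
    (hV : ∀ i, generator q u i + (a * (if i = j then 1 else 0) + b) * u i ≤ 0) {t : ℝ≥0}
    (ht : 0 < t) (i : Fin N) :
    ∫ ω, Real.exp ((a * occupation X j t ω + b) * t) ∂P i ≤ hi / lo := by
  have hu : ∀ i, 0 < u i := fun i => hlo.trans_le (hulo i)
  have hFK := hX.lintegral_exp_integral_le (V := fun k => a * (if k = j then (1 : ℝ) else 0) + b)
    hu hV ht i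
  have hhi : 0 ≤ hi := (hu i).le.trans (huhi i)
  rw [le_div_iff₀ hlo, ← integral_mul_const]
  rw [integral_eq_lintegral_of_nonneg_ae (Eventually.of_forall fun ω => by positivity)
    ((hX.integrable_exp_occupation i j a b ht).mul_const lo).aestronglyMeasurable]
  refine ENNReal.toReal_le_of_le_ofReal hhi (le_trans (lintegral_mono fun ω => ?_)
    (hFK.trans (ENNReal.ofReal_le_ofReal (huhi i))))
  refine ENNReal.ofReal_le_ofReal ?_
  rw [hX.integral_affine_path j a b ht ω]
  gcongr
  exact hulo _

section Poisson

variable {j : Fin N} {m B : ℝ} {f : Fin N → ℝ} {t : ℝ≥0}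

/-- Feynman–Kac with `u = 1 - (η / B) f`, which lies in `[1 - η, 1]`. As `f j = 0`, the potential at
`j` meets `u j = 1` exactly, so the indicator terms cancel without a second-order remainder; the
only loss is the replacement of `m` by `m / (1 - η)`, which pays for `u ≥ 1 - η` elsewhere. -/
theorem integral_exp_occupation_upper (hX : IsMarkovChain q P X) (hm : 0 < m) (hB : 0 < B)
    (hf : IsPoissonSolution q j m B f) {η : ℝ} (hη : 0 < η) (hη1 : η < 1) (ht : 0 < t)
    (i : Fin N) :
    ∫ ω, Real.exp ((η / B * occupation X j t ω + -(η / B * (m / (1 - η)))) * t) ∂P i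
      ≤ 1 / (1 - η) := by
  have hθ : 0 < η / B := by positivity
  have hb : ∀ i, η / B * f i ≤ η := fun i => by
    rw [div_mul_eq_mul_div, div_le_iff₀ hB]
    exact mul_le_mul_of_nonneg_left (hf.le i) hη.le
  have h1 : 0 < 1 - η := by linarith
  refine hX.integral_exp_occupation_le j _ _ (u := fun k => 1 + (-(η / B)) * f k) h1
    (fun k => by linarith [hb k]) (fun k => by nlinarith [hf.nonneg k]) (fun k => ?_) ht i
  rw [generator_const_add_mul, hf.eq]
  by_cases hk : k = j
  · subst hk
    rw [hf.self]
    simp only [if_true]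
    have : m ≤ m / (1 - η) := by rw [le_div_iff₀ h1]; nlinarith
    nlinarith
  · simp only [hk, if_false]
    have : m ≤ m / (1 - η) * (1 + -(η / B) * f k) := by
      rw [div_mul_eq_mul_div, le_div_iff₀ h1]
      exact mul_le_mul_of_nonneg_left (by linarith [hb k]) hm.le
    nlinarith

/-- The same argument with `u = 1 + (η / B) f`, which lies in `[1, 1 + η]`. -/
theorem integral_exp_occupation_lower (hX : IsMarkovChain q P X) (hm : 0 < m) (hB : 0 < B)
    (hf : IsPoissonSolution q j m B f) {η : ℝ} (hη : 0 < η) (ht : 0 < t) (i : Fin N) :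
    ∫ ω, Real.exp ((-(η / B) * occupation X j t ω + η / B * (m / (1 + η))) * t) ∂P i
      ≤ 1 + η := by
  have hθ : 0 < η / B := by positivity
  have hb : ∀ i, η / B * f i ≤ η := fun i => by
    rw [div_mul_eq_mul_div, div_le_iff₀ hB]
    exact mul_le_mul_of_nonneg_left (hf.le i) hη.le
  have h1 : 0 < 1 + η := by linarith
  rw [← div_one (1 + η)]
  refine hX.integral_exp_occupation_le j _ _ (u := fun k => 1 + (η / B) * f k) one_pos
    (fun k => by nlinarith [hf.nonneg k]) (fun k => by linarith [hb k]) (fun k => ?_) ht i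
  rw [generator_const_add_mul, hf.eq, div_one]
  by_cases hk : k = j
  · subst hk
    rw [hf.self]
    simp only [if_true]
    have : m / (1 + η) ≤ m := by rw [div_le_iff₀ h1]; nlinarith
    nlinarith
  · simp only [hk, if_false]
    have : m / (1 + η) * (1 + η / B * f k) ≤ m := by
      rw [div_mul_eq_mul_div, div_le_iff₀ h1]
      exact mul_le_mul_of_nonneg_left (by linarith [hb k]) hm.le
    nlinarith

/-- First-order part of the exponential bounds: use `1 + x ≤ exp x`, cancel the common factor `η`,
and let `η ↓ 0`. -/
theorem abs_integral_occupation_sub_le (hX : IsMarkovChain q P X) (hm : 0 < m) (hB : 0 < B)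
    (hf : IsPoissonSolution q j m B f) (ht : 0 < t) (i : Fin N) :
    |∫ ω, occupation X j t ω ∂P i - m| ≤ B / t := by
  have hprob := hX.isProbabilityMeasure i
  have ht' : (0 : ℝ) < t := by exact_mod_cast ht
  have hint := hX.integrable_occupation i j ht
  set E := ∫ ω, occupation X j t ω ∂P i with hE
  have lin : ∀ a b : ℝ, 1 + (a * E + b) * t
      ≤ ∫ ω, Real.exp ((a * occupation X j t ω + b) * t) ∂P i := by
    intro a b
    have hint' := (integrable_const (μ := P i) (1 + b * (t : ℝ))).add (hint.const_mul (a * t))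
    have h1 : 1 + (a * E + b) * t = ∫ ω, ((1 + b * t) + a * t * occupation X j t ω) ∂P i := by
      rw [integral_add (integrable_const _) (hint.const_mul _), integral_const_mul]
      simp [hE]
      ring
    rw [h1]
    refine integral_mono hint' (hX.integrable_exp_occupation i j a b ht) fun ω => ?_
    have := Real.add_one_le_exp ((a * occupation X j t ω + b) * t)
    simp only
    linarith
  have hid : Tendsto (fun η : ℝ => η) (𝓝[>] 0) (𝓝 0) := tendsto_id.mono_left nhdsWithin_le_nhds
  rw [abs_le]
  constructor
  · have hlim : Tendsto (fun η : ℝ => m / (1 + η) - B / t) (𝓝[>] 0) (𝓝 (m / (1 + 0) - B / t)) :=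
      ((tendsto_const_nhds).div (hid.const_add 1) (by norm_num)).sub_const _
    have : m / (1 + 0) - B / t ≤ E := by
      refine le_of_tendsto hlim (eventually_mem_nhdsWithin.mono fun η (hη : 0 < η) => ?_)
      have h2 := (lin _ _).trans (hX.integral_exp_occupation_lower hm hB hf hη ht i)
      have h3 : η * ((m / (1 + η) - E) * t) ≤ η * B := by
        have : (-(η / B) * E + η / B * (m / (1 + η))) * t
          = (η * ((m / (1 + η) - E) * t)) / B := by ring
        rw [this] at h2
        have h4 : (η * ((m / (1 + η) - E) * t)) / B ≤ η := by linarith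
        rwa [div_le_iff₀ hB] at h4
      have h4 := le_of_mul_le_mul_left h3 hη
      have h5 : m / (1 + η) - E ≤ B / t := by rwa [le_div_iff₀ ht']
      linarith
    rw [add_zero, div_one] at this
    linarith
  · have hlim : Tendsto (fun η : ℝ => m / (1 - η) + B / t / (1 - η)) (𝓝[>] 0)
        (𝓝 (m / (1 - 0) + B / t / (1 - 0))) :=
      ((tendsto_const_nhds).div (hid.const_sub 1) (by norm_num)).add
        ((tendsto_const_nhds).div (hid.const_sub 1) (by norm_num))
    have : E ≤ m / (1 - 0) + B / t / (1 - 0) := by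
      refine ge_of_tendsto hlim ?_
      filter_upwards [Ioo_mem_nhdsGT (zero_lt_one (α := ℝ))] with η hη
      have h1 : 0 < 1 - η := by linarith [hη.2]
      have h2 := (lin _ _).trans (hX.integral_exp_occupation_upper hm hB hf hη.1 hη.2 ht i)
      have h3 : η * ((E - m / (1 - η)) * t) ≤ η * (B / (1 - η)) := by
        have : (η / B * E + -(η / B * (m / (1 - η)))) * t
          = (η * ((E - m / (1 - η)) * t)) / B := by ring
        rw [this] at h2
        have h4 : (η * ((E - m / (1 - η)) * t)) / B ≤ η / (1 - η) := by
          have : 1 / (1 - η) = 1 + η / (1 - η) := by field_simp; ring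
          linarith
        rw [div_le_iff₀ hB] at h4
        calc _ ≤ _ := h4
          _ = _ := by ring
      have h4 := le_of_mul_le_mul_left h3 hη.1
      have h5 : E - m / (1 - η) ≤ B / t / (1 - η) := by
        rw [div_right_comm, le_div_iff₀ ht']; exact h4
      linarith
    simp only [sub_zero, div_one] at this
    linarith

theorem measureReal_le_of_integral_exp_le (hX : IsMarkovChain q P X) {i : Fin N} {a b K x : ℝ}
    (ht : 0 < t) (hK : ∫ ω, Real.exp ((a * occupation X j t ω + b) * t) ∂P i ≤ K) {A : Set Ω}
    (hA : ∀ ω ∈ A, x ≤ (a * occupation X j t ω + b) * t) :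
    (P i).real A ≤ K * Real.exp (-x) := by
  have hprob := hX.isProbabilityMeasure i
  have h := mul_meas_ge_le_integral_of_nonneg (Eventually.of_forall fun ω => (Real.exp_pos _).le)
    (hX.integrable_exp_occupation i j a b ht) (Real.exp x)
  have hsub : (P i).real A
      ≤ (P i).real {ω | Real.exp x ≤ Real.exp ((a * occupation X j t ω + b) * t)} :=
    measureReal_mono fun ω hω => Real.exp_le_exp.2 (hA ω hω)
  rw [Real.exp_neg, ← div_eq_mul_inv, le_div_iff₀ (Real.exp_pos x)]
  calc _ ≤ Real.exp x * (P i).real {ω | Real.exp x ≤ Real.exp ((a * occupation X j t ω + b) * t)} := by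
        rw [mul_comm]; gcongr
    _ ≤ K := h.trans hK

/-- Exponential Markov inequality with `η = c / 4`. Then `m / (1 - η) ≤ (1 + c / 2) m`, so half of
the deviation `c m` survives and the exponent is `(c / 4) / B * (c / 2) m * t`. -/
theorem measureReal_occupation_gt_le (hX : IsMarkovChain q P X) (hm : 0 < m) (hB : 0 < B)
    (hf : IsPoissonSolution q j m B f) (ht : 0 < t) {c : ℝ} (hc : 0 < c) (hc1 : c ≤ 1)
    (i : Fin N) :
    (P i).real {ω | (1 + c) * m < occupation X j t ω} ≤ 2 * Real.exp (-(c ^ 2 * m * t / (8 * B))) := by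
  have ht' : (0 : ℝ) < t := by exact_mod_cast ht
  have h1 : 0 < 1 - c / 4 := by linarith
  refine hX.measureReal_le_of_integral_exp_le (K := 2) ht
    ((hX.integral_exp_occupation_upper hm hB hf (η := c / 4) (by linarith) (by linarith) ht i).trans
      ?_) fun ω hω => ?_
  · rw [div_le_iff₀ h1]; linarith
  · have hω' : (1 + c) * m < occupation X j t ω := hω
    have h2 : m / (1 - c / 4) ≤ (1 + c / 2) * m := by
      rw [div_le_iff₀ h1]; nlinarith [mul_pos hm hc]
    have h3 : c / 2 * m ≤ occupation X j t ω - m / (1 - c / 4) := by linarith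
    calc c ^ 2 * m * t / (8 * B) = c / 4 / B * (c / 2 * m) * t := by field_simp; ring
      _ ≤ c / 4 / B * (occupation X j t ω - m / (1 - c / 4)) * t := by gcongr
      _ = _ := by ring

theorem measureReal_occupation_lt_le (hX : IsMarkovChain q P X) (hm : 0 < m) (hB : 0 < B)
    (hf : IsPoissonSolution q j m B f) (ht : 0 < t) {c : ℝ} (hc : 0 < c) (hc1 : c ≤ 1)
    (i : Fin N) :
    (P i).real {ω | occupation X j t ω < (1 - c) * m} ≤ 2 * Real.exp (-(c ^ 2 * m * t / (8 * B))) := by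
  have ht' : (0 : ℝ) < t := by exact_mod_cast ht
  have h1 : 0 < 1 + c / 4 := by linarith
  refine hX.measureReal_le_of_integral_exp_le (K := 2) ht
    ((hX.integral_exp_occupation_lower hm hB hf (η := c / 4) (by linarith) ht i).trans
      (by linarith)) fun ω hω => ?_
  have hω' : occupation X j t ω < (1 - c) * m := hω
  have h2 : (1 - c / 2) * m ≤ m / (1 + c / 4) := by
    rw [le_div_iff₀ h1]; nlinarith [mul_pos hm hc]
  have h3 : c / 2 * m ≤ m / (1 + c / 4) - occupation X j t ω := by linarith
  calc c ^ 2 * m * t / (8 * B) = c / 4 / B * (c / 2 * m) * t := by field_simp; ring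
    _ ≤ c / 4 / B * (m / (1 + c / 4) - occupation X j t ω) * t := by gcongr
    _ = _ := by ring

end Poisson

end IsMarkovChain

/-! ### Invariance and uniform ergodicity of the transition probabilities. -/

theorem generator_indicator_self (q : Fin N → Fin N → ℝ) (j : Fin N) :
    generator q (fun k => if k = j then 1 else 0) j = -exitRate q j := by
  unfold generator exitRate
  rw [← Finset.sum_neg_distrib]
  refine Finset.sum_congr rfl fun k hk => ?_
  simp [Finset.ne_of_mem_erase hk]

theorem generator_indicator_of_ne (q : Fin N → Fin N → ℝ) {i j : Fin N} (hij : i ≠ j) :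
    generator q (fun k => if k = j then 1 else 0) i = q i j := by
  unfold generator
  rw [Finset.sum_eq_single j]
  · simp [hij]
  · intro k _ hk; simp [hk, hij]
  · intro h; exact absurd (Finset.mem_erase.2 ⟨hij.symm, Finset.mem_univ j⟩) h

/-- Doeblin's contraction of oscillations. -/
theorem sum_mul_sub_sum_mul_le {K : Fin N → Fin N → ℝ} (hK0 : ∀ i j, 0 ≤ K i j)
    (hK1 : ∀ i, ∑ j, K i j = 1) {κ : ℝ} {j₀ : Fin N} (hκ : ∀ i, κ ≤ K i j₀) (hκ1 : κ ≤ 1)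
    {g : Fin N → ℝ} {d : ℝ} (hg : ∀ i k, g i - g k ≤ d) (i k : Fin N) :
    ∑ l, K i l * g l - ∑ l, K k l * g l ≤ (1 - κ) * d := by
  obtain ⟨a, -, ha⟩ := Finset.exists_max_image Finset.univ g ⟨i, Finset.mem_univ i⟩
  obtain ⟨b, -, hb⟩ := Finset.exists_min_image Finset.univ g ⟨i, Finset.mem_univ i⟩
  have h1 : κ * (g a - g j₀) ≤ g a - ∑ l, K i l * g l := by
    calc κ * (g a - g j₀) ≤ K i j₀ * (g a - g j₀) :=
          mul_le_mul_of_nonneg_right (hκ i) (by linarith [ha j₀ (Finset.mem_univ _)])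
      _ ≤ ∑ l, K i l * (g a - g l) :=
          Finset.single_le_sum (f := fun l => K i l * (g a - g l))
            (fun l hl => mul_nonneg (hK0 i l) (by linarith [ha l hl])) (Finset.mem_univ j₀)
      _ = g a - ∑ l, K i l * g l := by
          simp only [mul_sub, Finset.sum_sub_distrib, ← Finset.sum_mul, hK1, one_mul]
  have h2 : κ * (g j₀ - g b) ≤ ∑ l, K k l * g l - g b := by
    calc κ * (g j₀ - g b) ≤ K k j₀ * (g j₀ - g b) :=
          mul_le_mul_of_nonneg_right (hκ k) (by linarith [hb j₀ (Finset.mem_univ _)])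
      _ ≤ ∑ l, K k l * (g l - g b) :=
          Finset.single_le_sum (f := fun l => K k l * (g l - g b))
            (fun l hl => mul_nonneg (hK0 k l) (by linarith [hb l hl])) (Finset.mem_univ j₀)
      _ = ∑ l, K k l * g l - g b := by
          simp only [mul_sub, Finset.sum_sub_distrib, ← Finset.sum_mul, hK1, one_mul]
  have h3 : (1 - κ) * (g a - g b) ≤ (1 - κ) * d :=
    mul_le_mul_of_nonneg_left (hg a b) (by linarith)
  linarith

namespace IsMarkovChain

variable {Ω : Type*} [MeasurableSpace Ω] {q : Fin N → Fin N → ℝ} {P : Fin N → Measure Ω}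
  {X : ℝ≥0 → Ω → Fin N}

/-- The transition matrix is differentiable at time `0`, with derivative the rate matrix. -/
theorem tendsto_transProb_sub_div (hX : IsMarkovChain q P X) (i j : Fin N) :
    Tendsto (fun h : ℝ≥0 => (transProb P X h i j - if i = j then 1 else 0) / (h : ℝ))
      (𝓝[>] 0) (𝓝 (generator q (fun k => if k = j then 1 else 0) i)) := by
  have := hX.tendsto_weighted_transProb (fun _ => 0) (fun k => if k = j then 1 else 0) i
  simpa using this

theorem transProb_pow_le (hX : IsMarkovChain q P X) (h : ℝ≥0) (j : Fin N) (n : ℕ) :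
    transProb P X h j j ^ n ≤ transProb P X ((n : ℝ≥0) * h) j j := by
  induction n with
  | zero => simp [hX.transProb_zero_self]
  | succ n ih =>
    have : ((n + 1 : ℕ) : ℝ≥0) * h = (n : ℝ≥0) * h + h := by push_cast; ring
    rw [this, hX.transProb_add, pow_succ]
    calc _ ≤ transProb P X ((n : ℝ≥0) * h) j j * transProb P X h j j :=
          mul_le_mul_of_nonneg_right ih (transProb_nonneg P X h j j)
      _ ≤ _ := Finset.single_le_sum (f := fun l => transProb P X ((n : ℝ≥0) * h) j l
            * transProb P X h l j) (fun l _ => mul_nonneg (transProb_nonneg P X _ _ _)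
              (transProb_nonneg P X _ _ _)) (Finset.mem_univ j)

theorem exp_le_transProb_self (hX : IsMarkovChain q P X) {j : Fin N} (hj : 0 < exitRate q j)
    (r : ℝ≥0) : Real.exp (-(2 * exitRate q j * r)) ≤ transProb P X r j j := by
  rcases eq_or_ne r 0 with rfl | hr
  · simp [hX.transProb_zero_self]
  have hr0 : 0 < r := pos_iff_ne_zero.2 hr
  have hev : ∀ᶠ h : ℝ≥0 in 𝓝[>] 0, 1 + -(2 * exitRate q j * h) ≤ transProb P X h j j := by
    have h1 := hX.tendsto_transProb_sub_div j j
    rw [generator_indicator_self] at h1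
    -- Doubling the rate absorbs the `o(h)` error in the probability of not being at `j`.
    filter_upwards [h1.eventually_const_lt (show -(2 * exitRate q j) < -exitRate q j by linarith),
      self_mem_nhdsWithin] with h h2 h3
    have hpos : (0 : ℝ) < h := by exact_mod_cast (h3 : (0 : ℝ≥0) < h)
    rw [lt_div_iff₀ hpos] at h2
    simp only [if_true] at h2
    linarith
  have hlim := (Real.tendsto_one_add_div_pow_exp (-(2 * exitRate q j * r))).comp
    (tendsto_add_atTop_nat 1)
  refine le_of_tendsto hlim ?_
  have hstep := tendsto_step hr0
  have hsmall : ∀ᶠ h : ℝ≥0 in 𝓝[>] 0, 0 ≤ 1 + -(2 * exitRate q j * (h : ℝ)) := by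
    have : Tendsto (fun h : ℝ≥0 => 1 + -(2 * exitRate q j * (h : ℝ))) (𝓝[>] 0)
        (𝓝 (1 + -(2 * exitRate q j * 0))) :=
      (((tendsto_coe_nhdsGT_zero.mono_right nhdsWithin_le_nhds).const_mul _).neg).const_add 1
    rw [mul_zero, neg_zero, add_zero] at this
    exact this.eventually_const_le one_pos
  filter_upwards [hstep.eventually hev, hstep.eventually hsmall] with n hn hn0
  have h1 := hX.transProb_pow_le (r / ((n : ℝ≥0) + 1)) j (n + 1)
  have hend : ((n + 1 : ℕ) : ℝ≥0) * (r / ((n : ℝ≥0) + 1)) = r := by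
    push_cast; field_simp
  rw [hend] at h1
  refine le_trans ?_ h1
  have heq : 1 + -(2 * exitRate q j * r) / ((n + 1 : ℕ) : ℝ)
      = 1 + -(2 * exitRate q j * ((r / ((n : ℝ≥0) + 1) : ℝ≥0) : ℝ)) := by
    push_cast; ring
  simp only [Function.comp]
  rw [heq]
  exact pow_le_pow_left₀ hn0 hn _

/-- The mean occupation is a time average of transition probabilities; Riemann sums replace Fubini,
so no joint measurability in time and `ω` is needed. -/
theorem integral_occupation_le (hX : IsMarkovChain q P X) (i j : Fin N) {s : ℝ≥0} (hs : 0 < s)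
    {b : ℝ} (hb : ∀ r ≤ s, transProb P X r i j ≤ b) :
    ∫ ω, occupation X j s ω ∂P i ≤ b := by
  have hprob := hX.isProbabilityMeasure i
  have hs' : (0 : ℝ) < s := by exact_mod_cast hs
  set R : ℕ → Ω → ℝ := fun n ω => (∑ k ∈ Finset.range (n + 1),
      (fun l => if l = j then (1 : ℝ) else 0) (X (((k : ℝ≥0) + 1) * (s / ((n : ℝ≥0) + 1))) ω)
        * ((s : ℝ) / ((n : ℝ) + 1))) / s with hR
  have hRm : ∀ (n k : ℕ), Measurable fun ω =>
      (fun l => if l = j then (1 : ℝ) else 0) (X (((k : ℝ≥0) + 1) * (s / ((n : ℝ≥0) + 1))) ω)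
        * ((s : ℝ) / ((n : ℝ) + 1)) := fun n k =>
    ((measurable_of_countable (fun l : Fin N => if l = j then (1 : ℝ) else 0)).comp
      (hX.measurable _)).mul_const _
  have hterm : ∀ (n k : ℕ) (ω : Ω),
      |(fun l => if l = j then (1 : ℝ) else 0) (X (((k : ℝ≥0) + 1) * (s / ((n : ℝ≥0) + 1))) ω)
        * ((s : ℝ) / ((n : ℝ) + 1))| ≤ (s : ℝ) / ((n : ℝ) + 1) := by
    intro n k ω
    have : (0 : ℝ) ≤ (s : ℝ) / ((n : ℝ) + 1) := by positivity
    simp only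
    split_ifs <;> simp [abs_of_nonneg this, this]
  have hlim : Tendsto (fun n => ∫ ω, R n ω ∂P i) atTop (𝓝 (∫ ω, occupation X j s ω ∂P i)) := by
    refine tendsto_integral_of_dominated_convergence (fun _ => 1)
      (fun n => ((Finset.measurable_fun_sum _ fun k _ => hRm n k).div_const _).aestronglyMeasurable)
      (integrable_const _) (fun n => Eventually.of_forall fun ω => ?_)
      (Eventually.of_forall fun ω => ?_)
    swap
    · rw [occupation_eq]
      exact (hX.tendsto_riemann_sum_path (fun l => if l = j then (1 : ℝ) else 0) ω hs).div_const _
    rw [hR, Real.norm_eq_abs, abs_div, abs_of_pos hs', div_le_one hs']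
    refine (Finset.abs_sum_le_sum_abs _ _).trans ((Finset.sum_le_sum fun k _ => hterm n k ω).trans ?_)
    rw [Finset.sum_const, Finset.card_range, nsmul_eq_mul]
    push_cast
    exact le_of_eq (by field_simp)
  refine le_of_tendsto hlim (Eventually.of_forall fun n => ?_)
  have hI : ∫ ω, R n ω ∂P i = (∑ k ∈ Finset.range (n + 1),
      transProb P X (((k : ℝ≥0) + 1) * (s / ((n : ℝ≥0) + 1))) i j * ((s : ℝ) / ((n : ℝ) + 1))) / s := by
    rw [hR, integral_div, integral_finsetSum _ fun k _ => Integrable.of_bound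
      (hRm n k).aestronglyMeasurable _ (Eventually.of_forall fun ω => hterm n k ω)]
    congr 1
    refine Finset.sum_congr rfl fun k _ => ?_
    rw [integral_mul_const]
    congr 1
    rw [transProb, ← integral_indicator_one (hX.measurableSet_state _ j)]
    simp [Set.indicator_apply]
  rw [hI, div_le_iff₀ hs']
  calc _ ≤ ∑ k ∈ Finset.range (n + 1), b * ((s : ℝ) / ((n : ℝ) + 1)) := by
        refine Finset.sum_le_sum fun k hk => mul_le_mul_of_nonneg_right (hb _ ?_) (by positivity)
        rw [← mul_div_assoc, div_le_iff₀ (by positivity), mul_comm]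
        gcongr
        exact Nat.lt_succ_iff.1 (Finset.mem_range.1 hk)
    _ = b * s := by
        rw [Finset.sum_const, Finset.card_range, nsmul_eq_mul]
        push_cast
        field_simp

/-- A measure annihilated by the generator is invariant under the transition probabilities. -/
theorem sum_mul_transProb (hX : IsMarkovChain q P X) {π : Fin N → ℝ} (hπ : IsInvariantRates q π)
    (t : ℝ≥0) (j : Fin N) : ∑ i, π i * transProb P X t i j = π j := by
  -- The `ℓ¹` defect of invariance is subadditive in time, because transition matrices contract the
  -- `ℓ¹` norm, and it is `o(h)` at `0`. Hence `e t ≤ (n + 1) e (t / (n + 1)) → 0`.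
  set e : ℝ≥0 → ℝ := fun h => ∑ j, |∑ i, π i * transProb P X h i j - π j| with he
  have hbase : Tendsto (fun h : ℝ≥0 => e h / (h : ℝ)) (𝓝[>] 0) (𝓝 0) := by
    have hj : ∀ j, Tendsto (fun h : ℝ≥0 => |(∑ i, π i * transProb P X h i j - π j) / (h : ℝ)|)
        (𝓝[>] 0) (𝓝 0) := by
      intro j
      have h1 := tendsto_finsetSum Finset.univ
        (fun i _ => (hX.tendsto_transProb_sub_div i j).const_mul (π i))
      have hz : ∑ i, π i * generator q (fun k => if k = j then 1 else 0) i = 0 := by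
        rw [← Finset.add_sum_erase _ _ (Finset.mem_univ j), generator_indicator_self,
          Finset.sum_congr rfl fun i hi => by
            rw [generator_indicator_of_ne q (Finset.ne_of_mem_erase hi)], hπ.2 j]
        ring
      rw [hz] at h1
      have h2 := h1.abs
      rw [abs_zero] at h2
      refine h2.congr fun h => ?_
      congr 1
      simp only [← mul_div_assoc, mul_sub, ← Finset.sum_div, Finset.sum_sub_distrib, mul_ite,
        mul_one, mul_zero, Finset.sum_ite_eq', Finset.mem_univ, if_true]
    have h2 := tendsto_finsetSum Finset.univ (fun j _ => hj j)
    rw [Finset.sum_const_zero] at h2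
    refine h2.congr fun h => ?_
    simp only [he, abs_div, Finset.sum_div, NNReal.abs_eq]
  have hiter : ∀ (h : ℝ≥0) (n : ℕ), e ((n : ℝ≥0) * h) ≤ n * e h := by
    intro h n
    induction n with
    | zero =>
      have h0 : ∀ i j, transProb P X 0 i j = if i = j then 1 else 0 := by
        intro i j
        by_cases hij : i = j
        · subst hij; simp [hX.transProb_zero_self]
        · have h1 := hX.sum_transProb 0 i
          rw [← Finset.add_sum_erase _ _ (Finset.mem_univ i), hX.transProb_zero_self] at h1
          have h2 := (Finset.sum_eq_zero_iff_of_nonneg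
            (fun k _ => transProb_nonneg P X 0 i k)).1 (by linarith :
              ∑ k ∈ Finset.univ.erase i, transProb P X 0 i k = 0) j
            (Finset.mem_erase.2 ⟨fun h => hij h.symm, Finset.mem_univ j⟩)
          simp [hij, h2]
      simp [he, h0]
    | succ n ih =>
      have hn : ((n + 1 : ℕ) : ℝ≥0) * h = (n : ℝ≥0) * h + h := by push_cast; ring
      rw [hn]
      set s := (n : ℝ≥0) * h with hs
      have hsplit : ∀ j, ∑ i, π i * transProb P X (s + h) i j - π j
          = ∑ k, (∑ i, π i * transProb P X s i k - π k) * transProb P X h k j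
            + (∑ i, π i * transProb P X h i j - π j) := by
        intro j
        have : ∑ i, π i * transProb P X (s + h) i j
            = ∑ k, (∑ i, π i * transProb P X s i k) * transProb P X h k j := by
          simp_rw [hX.transProb_add s h, Finset.mul_sum, Finset.sum_mul]
          rw [Finset.sum_comm]
          simp_rw [mul_assoc]
        rw [this]
        simp only [sub_mul, Finset.sum_sub_distrib]
        ring
      calc e (s + h) ≤ ∑ j, (∑ k, |∑ i, π i * transProb P X s i k - π k| * transProb P X h k j
            + |∑ i, π i * transProb P X h i j - π j|) := by
            refine Finset.sum_le_sum fun j _ => ?_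
            rw [hsplit j]
            refine (abs_add_le _ _).trans (add_le_add ?_ le_rfl)
            refine (Finset.abs_sum_le_sum_abs _ _).trans (Finset.sum_le_sum fun k _ => ?_)
            rw [abs_mul, abs_of_nonneg (transProb_nonneg P X h k j)]
        _ = e s + e h := by
            rw [Finset.sum_add_distrib, Finset.sum_comm]
            simp_rw [← Finset.mul_sum, hX.sum_transProb, mul_one]
            rfl
        _ ≤ ((n + 1 : ℕ) : ℝ) * e h := by push_cast; linarith
  have he0 : ∀ h, 0 ≤ e h := fun h => Finset.sum_nonneg fun _ _ => abs_nonneg _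
  rcases eq_or_ne t 0 with rfl | ht
  · have := hiter 0 0
    simp only [Nat.cast_zero, zero_mul] at this
    have h1 := (Finset.sum_eq_zero_iff_of_nonneg (fun _ _ => abs_nonneg _)).1
      (le_antisymm this (he0 0)) j (Finset.mem_univ j)
    linarith [abs_eq_zero.1 h1]
  have ht0 : 0 < t := pos_iff_ne_zero.2 ht
  have hlim := ((hbase.comp (tendsto_step ht0)).const_mul (t : ℝ))
  rw [mul_zero] at hlim
  have hzero : e t ≤ 0 := by
    refine ge_of_tendsto hlim (Eventually.of_forall fun n => ?_)
    have h1 := hiter (t / ((n : ℝ≥0) + 1)) (n + 1)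
    have hend : ((n + 1 : ℕ) : ℝ≥0) * (t / ((n : ℝ≥0) + 1)) = t := by
      push_cast; field_simp
    rw [hend] at h1
    refine h1.trans (le_of_eq ?_)
    have ht' : (t : ℝ) ≠ 0 := by exact_mod_cast ht
    simp only [Function.comp]
    push_cast
    field_simp
  have h1 := (Finset.sum_eq_zero_iff_of_nonneg (fun _ _ => abs_nonneg _)).1
      (le_antisymm hzero (he0 t)) j (Finset.mem_univ j)
  linarith [abs_eq_zero.1 h1]

theorem transProb_sub_le_pow (hX : IsMarkovChain q P X) {κ : ℝ} {s : ℝ≥0} {j₀ : Fin N}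
    (hκ : ∀ i, κ ≤ transProb P X s i j₀) (r : ℝ≥0) (j : Fin N) (n : ℕ) (i k : Fin N) :
    transProb P X ((n : ℝ≥0) * s + r) i j - transProb P X ((n : ℝ≥0) * s + r) k j
      ≤ (1 - κ) ^ n := by
  induction n generalizing i k with
  | zero =>
    simp only [Nat.cast_zero, zero_mul, zero_add, pow_zero]
    linarith [hX.transProb_le_one r i j, transProb_nonneg P X r k j]
  | succ n ih =>
    have : ((n + 1 : ℕ) : ℝ≥0) * s + r = s + ((n : ℝ≥0) * s + r) := by push_cast; ring
    rw [this, hX.transProb_add, hX.transProb_add, pow_succ']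
    exact sum_mul_sub_sum_mul_le (transProb_nonneg P X s) (hX.sum_transProb s) hκ
      ((hκ i).trans (hX.transProb_le_one s i j₀)) ih i k

theorem abs_transProb_sub_le (hX : IsMarkovChain q P X) {π : Fin N → ℝ}
    (hπ : IsInvariantRates q π) {κ : ℝ} {s : ℝ≥0} {j₀ : Fin N}
    (hκ : ∀ i, κ ≤ transProb P X s i j₀) (r : ℝ≥0) (i j : Fin N) (n : ℕ) :
    |transProb P X ((n : ℝ≥0) * s + r) i j - π j| ≤ (1 - κ) ^ n := by
  have hosc := hX.transProb_sub_le_pow hκ r j n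
  have hinv := hX.sum_mul_transProb hπ ((n : ℝ≥0) * s + r) j
  set p := transProb P X ((n : ℝ≥0) * s + r) with hp
  have h1 : p i j = ∑ k, π k * p i j := by rw [← Finset.sum_mul, hπ.1.2, one_mul]
  have hc : ∑ k, π k * (1 - κ) ^ n = (1 - κ) ^ n := by rw [← Finset.sum_mul, hπ.1.2, one_mul]
  have h2 : p i j - π j = ∑ k, π k * (p i j - p k j) := by
    simp only [mul_sub, Finset.sum_sub_distrib]; rw [← h1, hinv]
  rw [abs_le]
  constructor
  · have : π j - p i j = ∑ k, π k * (p k j - p i j) := by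
      simp only [mul_sub, Finset.sum_sub_distrib]; rw [← h1, hinv]
    have h3 : π j - p i j ≤ (1 - κ) ^ n := by
      rw [this, ← hc]
      exact Finset.sum_le_sum fun k _ => mul_le_mul_of_nonneg_left (hosc k i) (hπ.1.1 k)
    linarith
  · rw [h2, ← hc]
    exact Finset.sum_le_sum fun k _ => mul_le_mul_of_nonneg_left (hosc i k) (hπ.1.1 k)

/-- Uniform ergodicity at the time scale `τ`. -/
theorem abs_transProb_sub_le_of_poisson (hX : IsMarkovChain q P X) {π : Fin N → ℝ}
    (hπ : IsInvariantRates q π) (hπ0 : ∀ j, 0 < π j) (hq : ∀ i j, i ≠ j → 0 ≤ q i j)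
    {C τ : ℝ} (hC : 0 < C) (hτ : 0 < τ)
    {j₀ : Fin N} (hj₀ : 0 < exitRate q j₀) (hj₀τ : exitRate q j₀ * τ ≤ 1) {f : Fin N → ℝ}
    (hf : IsPoissonSolution q j₀ (π j₀) (C * π j₀ * τ) f) (t : ℝ≥0) (i j : Fin N) :
    |transProb P X t i j - π j|
      ≤ (1 - Real.exp (-(8 * C)) / (2 * (1 + C))) ^ ⌊(t : ℝ) / (4 * C * τ)⌋₊ := by
  obtain ⟨s, hsval⟩ : ∃ s : ℝ≥0, (s : ℝ) = 4 * C * τ := ⟨⟨4 * C * τ, by positivity⟩, rfl⟩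
  have hs : 0 < s := by
    have : (0 : ℝ) < s := by rw [hsval]; positivity
    exact_mod_cast this
  have hm := hπ0 j₀
  have hB : 0 < C * π j₀ * τ := by positivity
  -- The Poisson equation at `j₀` reads `1 - π j₀ = ∑ k, q j₀ k * f k`, and the right side is at
  -- most `exitRate * C π j₀ τ ≤ C π j₀`.
  have hlow : 1 ≤ (1 + C) * π j₀ := by
    have h1 := hf.eq j₀
    simp only [if_true, generator, hf.self, sub_zero] at h1
    have h2 : ∑ k ∈ Finset.univ.erase j₀, q j₀ k * f k
        ≤ exitRate q j₀ * (C * π j₀ * τ) := by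
      rw [exitRate, Finset.sum_mul]
      exact Finset.sum_le_sum fun k hk => mul_le_mul_of_nonneg_left (hf.le k)
        (hq _ _ (Finset.ne_of_mem_erase hk).symm)
    have h3 : exitRate q j₀ * (C * π j₀ * τ) ≤ C * π j₀ := by
      calc _ = exitRate q j₀ * τ * (C * π j₀) := by ring
        _ ≤ 1 * (C * π j₀) := by gcongr
        _ = _ := one_mul _
    linarith
  -- With `s = 4 C τ` the error `B / s` is `π j₀ / 4`, so the mean occupation of `j₀` exceeds `π j₀
  -- / 2` and some `r ≤ s` has transition probability at least `π j₀ / 2`. Remaining at `j₀` until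
  -- `s` costs at most a factor `exp (-8 C)`.
  have hκ : ∀ i, Real.exp (-(8 * C)) / (2 * (1 + C)) ≤ transProb P X s i j₀ := by
    intro i
    obtain ⟨r, hr, hpr⟩ : ∃ r ≤ s, π j₀ / 2 ≤ transProb P X r i j₀ := by
      by_contra! hcon
      have h1 := hX.integral_occupation_le i j₀ hs (fun r hr => (hcon r hr).le)
      have h2 := (abs_le.1 (hX.abs_integral_occupation_sub_le hm hB hf hs i)).1
      rw [hsval] at h2
      have : C * π j₀ * τ / (4 * C * τ) = π j₀ / 4 := by field_simp
      rw [this] at h2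
      linarith
    obtain ⟨r', hrr⟩ := exists_add_of_le hr
    have hr' : (r' : ℝ) ≤ 4 * C * τ := by
      rw [← hsval, hrr]; push_cast; linarith [r.coe_nonneg]
    have h3 := hX.exp_le_transProb_self hj₀ r'
    have h4 : Real.exp (-(8 * C)) ≤ Real.exp (-(2 * exitRate q j₀ * r')) := by
      refine Real.exp_le_exp.2 (neg_le_neg ?_)
      calc 2 * exitRate q j₀ * r' ≤ 2 * exitRate q j₀ * (4 * C * τ) := by gcongr
        _ = 8 * C * (exitRate q j₀ * τ) := by ring
        _ ≤ 8 * C * 1 := by gcongr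
        _ = _ := mul_one _
    rw [hrr, hX.transProb_add]
    calc Real.exp (-(8 * C)) / (2 * (1 + C)) = 1 / (1 + C) / 2 * Real.exp (-(8 * C)) := by
          field_simp
      _ ≤ π j₀ / 2 * transProb P X r' j₀ j₀ := by
          refine mul_le_mul ?_ (h4.trans h3) (Real.exp_pos _).le (by positivity)
          gcongr
          rw [div_le_iff₀ (by positivity)]
          linarith
      _ ≤ transProb P X r i j₀ * transProb P X r' j₀ j₀ :=
          mul_le_mul_of_nonneg_right hpr (transProb_nonneg P X _ _ _)
      _ ≤ _ := Finset.single_le_sum (f := fun l => transProb P X r i l * transProb P X r' l j₀)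
          (fun l _ => mul_nonneg (transProb_nonneg P X _ _ _) (transProb_nonneg P X _ _ _))
          (Finset.mem_univ j₀)
  have hfl : ((⌊(t : ℝ) / (4 * C * τ)⌋₊ : ℕ) : ℝ≥0) * s ≤ t := by
    rw [← NNReal.coe_le_coe]
    push_cast
    rw [hsval]
    have := Nat.floor_le (a := (t : ℝ) / (4 * C * τ)) (by positivity)
    rwa [le_div_iff₀ (by positivity)] at this
  obtain ⟨r, hr⟩ := exists_add_of_le hfl
  have := hX.abs_transProb_sub_le hπ hκ r i j ⌊(t : ℝ) / (4 * C * τ)⌋₊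
  rwa [← hr] at this

end IsMarkovChain

/-! ### Invariant measures and solvability of the Poisson equation. -/

theorem sum_sum_erase_comm (F : Fin N → Fin N → ℝ) :
    ∑ j, ∑ i ∈ Finset.univ.erase j, F i j = ∑ i, ∑ j ∈ Finset.univ.erase i, F i j :=
  Finset.sum_comm' (by simp [ne_comm])

/-- The rate matrix kills constants, hence has a nonzero left null vector `v`. The triangle
inequality makes `|v|` subinvariant, and summing over states forces equality everywhere, so `|v|`
normalises to an invariant measure. -/
theorem exists_isInvariantRates (hN : 0 < N) {q : Fin N → Fin N → ℝ}
    (hq : ∀ i j, i ≠ j → 0 < q i j) : ∃ π, IsInvariantRates q π := by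
  set M : Matrix (Fin N) (Fin N) ℝ := fun i j => if i = j then -exitRate q i else q i j with hM
  have hdet : M.det = 0 := by
    rw [← Matrix.exists_mulVec_eq_zero_iff]
    refine ⟨fun _ => 1, fun h => one_ne_zero (congrFun h ⟨0, hN⟩), ?_⟩
    ext i
    simp only [Matrix.mulVec, dotProduct, mul_one, Pi.zero_apply]
    rw [← Finset.add_sum_erase _ _ (Finset.mem_univ i),
      Finset.sum_congr rfl fun j hj => (if_neg (Finset.ne_of_mem_erase hj).symm : M i j = q i j)]
    simp [hM, exitRate]
  obtain ⟨v, hv0, hv⟩ := Matrix.exists_vecMul_eq_zero_iff.2 hdet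
  have hbal : ∀ j, ∑ i ∈ Finset.univ.erase j, v i * q i j = v j * exitRate q j := by
    intro j
    have h := congrFun hv j
    simp only [Matrix.vecMul, dotProduct, Pi.zero_apply] at h
    rw [← Finset.add_sum_erase _ _ (Finset.mem_univ j),
      Finset.sum_congr rfl fun i hi =>
        (by rw [hM]; simp [Finset.ne_of_mem_erase hi] : v i * M i j = v i * q i j)] at h
    simp only [hM, if_true] at h
    linarith
  have hexit : ∀ j, 0 ≤ exitRate q j := fun j => Finset.sum_nonneg fun k hk =>
    (hq _ _ (Finset.ne_of_mem_erase hk).symm).le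
  have hle : ∀ j, |v j| * exitRate q j ≤ ∑ i ∈ Finset.univ.erase j, |v i| * q i j := by
    intro j
    calc |v j| * exitRate q j = |∑ i ∈ Finset.univ.erase j, v i * q i j| := by
          rw [hbal, abs_mul, abs_of_nonneg (hexit j)]
      _ ≤ ∑ i ∈ Finset.univ.erase j, |v i * q i j| := Finset.abs_sum_le_sum_abs _ _
      _ = _ := Finset.sum_congr rfl fun i hi => by
          rw [abs_mul, abs_of_pos (hq _ _ (Finset.ne_of_mem_erase hi))]
  have htot : ∑ j, |v j| * exitRate q j = ∑ j, ∑ i ∈ Finset.univ.erase j, |v i| * q i j := by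
    rw [sum_sum_erase_comm]
    simp only [exitRate, Finset.mul_sum]
  have heq := (Finset.sum_eq_sum_iff_of_le fun j _ => hle j).1 htot
  have hS : 0 < ∑ i, |v i| := by
    obtain ⟨i, hi⟩ := Function.ne_iff.1 hv0
    exact Finset.sum_pos' (fun _ _ => abs_nonneg _) ⟨i, Finset.mem_univ i, abs_pos.2 hi⟩
  refine ⟨fun i => |v i| / ∑ i, |v i|, ⟨fun i => by positivity, ?_⟩, fun j => ?_⟩
  · rw [← Finset.sum_div, div_self hS.ne']
  · simp only [div_mul_eq_mul_div, ← Finset.sum_div]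
    rw [heq j (Finset.mem_univ j)]

theorem IsInvariantRates.pos {q : Fin N → Fin N → ℝ} (hq : ∀ i j, i ≠ j → 0 < q i j)
    {π : Fin N → ℝ} (hπ : IsInvariantRates q π) (j : Fin N) : 0 < π j := by
  refine (hπ.1.1 j).lt_of_ne' fun h0 => ?_
  have h1 := hπ.2 j
  rw [h0, zero_mul, Finset.sum_eq_zero_iff_of_nonneg fun i hi =>
    mul_nonneg (hπ.1.1 i) (hq _ _ (Finset.ne_of_mem_erase hi)).le] at h1
  have h2 : ∀ i, π i = 0 := by
    intro i
    by_cases hi : i = j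
    · rw [hi, h0]
    · exact (mul_eq_zero.1 (h1 i (Finset.mem_erase.2 ⟨hi, Finset.mem_univ i⟩))).resolve_right
        (hq i j hi).ne'
  have h3 := hπ.1.2
  simp [h2] at h3

theorem exitRate_pos (hN : 2 ≤ N) {q : Fin N → Fin N → ℝ} (hq : ∀ i j, i ≠ j → 0 < q i j)
    (i : Fin N) : 0 < exitRate q i := by
  refine Finset.sum_pos (fun k hk => hq _ _ (Finset.ne_of_mem_erase hk).symm) ?_
  rw [← Finset.card_pos, Finset.card_erase_of_mem (Finset.mem_univ i), Finset.card_univ,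
    Fintype.card_fin]
  omega

theorem sum_mul_generator {q : Fin N → Fin N → ℝ} {π : Fin N → ℝ} (hπ : IsInvariantRates q π)
    (f : Fin N → ℝ) : ∑ i, π i * generator q f i = 0 := by
  have h1 : ∀ i, π i * generator q f i
      = ∑ j ∈ Finset.univ.erase i, π i * q i j * f j - π i * exitRate q i * f i := by
    intro i
    simp only [generator, exitRate, Finset.mul_sum, Finset.sum_mul, ← Finset.sum_sub_distrib]
    exact Finset.sum_congr rfl fun j _ => by ring
  simp only [h1, Finset.sum_sub_distrib]
  rw [← sum_sum_erase_comm (fun i j => π i * q i j * f j)]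
  simp only [← Finset.sum_mul, hπ.2, sub_self]

theorem eq_of_generator_eq_zero {q : Fin N → Fin N → ℝ} (hq : ∀ i j, i ≠ j → 0 < q i j)
    {f : Fin N → ℝ} (hf : ∀ i, generator q f i = 0) (i k : Fin N) : f i = f k := by
  obtain ⟨a, -, ha⟩ := Finset.exists_max_image Finset.univ f ⟨i, Finset.mem_univ i⟩
  have h : ∀ l, f l = f a := by
    intro l
    by_cases hl : l = a
    · rw [hl]
    have h1 := (Finset.sum_eq_zero_iff_of_nonpos fun l hl =>
      mul_nonpos_of_nonneg_of_nonpos (hq a l (Finset.ne_of_mem_erase hl).symm).le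
        (sub_nonpos.2 (ha l (Finset.mem_univ l)))).1 (hf a) l
        (Finset.mem_erase.2 ⟨hl, Finset.mem_univ l⟩)
    linarith [(mul_eq_zero.1 h1).resolve_left (hq a l (Ne.symm hl)).ne']
  rw [h i, h k]

/-- Fredholm alternative by dimension count: the kernel of the generator is at most the constants,
so its range has codimension at most one and fills the hyperplane orthogonal to `π`. -/
theorem exists_generator_eq {q : Fin N → Fin N → ℝ} (hq : ∀ i j, i ≠ j → 0 < q i j)
    {π : Fin N → ℝ} (hπ : IsInvariantRates q π) {g : Fin N → ℝ} (hg : ∑ i, π i * g i = 0) :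
    ∃ f, ∀ i, generator q f i = g i := by
  let G : (Fin N → ℝ) →ₗ[ℝ] (Fin N → ℝ) :=
    { toFun := generator q
      map_add' := fun f g => by
        ext i
        simp only [generator, Pi.add_apply, ← Finset.sum_add_distrib]
        exact Finset.sum_congr rfl fun j _ => by ring
      map_smul' := fun c f => by
        ext i
        simp only [generator, Pi.smul_apply, smul_eq_mul, RingHom.id_apply, Finset.mul_sum]
        exact Finset.sum_congr rfl fun j _ => by ring }
  let φ : (Fin N → ℝ) →ₗ[ℝ] ℝ :=
    { toFun := fun g => ∑ i, π i * g i
      map_add' := fun f g => by simp [mul_add, Finset.sum_add_distrib]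
      map_smul' := fun c f => by
        simp only [Pi.smul_apply, smul_eq_mul, RingHom.id_apply, Finset.mul_sum]
        exact Finset.sum_congr rfl fun j _ => by ring }
  have hker : G.ker ≤ Submodule.span ℝ {fun _ => (1 : ℝ)} := by
    intro f hf
    rw [Submodule.mem_span_singleton]
    have hf0 : ∀ i, generator q f i = 0 := fun i => congrFun (LinearMap.mem_ker.1 hf) i
    rcases isEmpty_or_nonempty (Fin N) with h | ⟨⟨i⟩⟩
    · exact ⟨0, Subsingleton.elim _ _⟩
    · exact ⟨f i, funext fun k => by simp [eq_of_generator_eq_zero hq hf0 i k]⟩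
  have hker1 : Module.finrank ℝ G.ker ≤ 1 :=
    (Submodule.finrank_mono hker).trans (finrank_span_le_card (R := ℝ) _ |>.trans (by simp))
  have hle : G.range ≤ φ.ker := by
    rintro _ ⟨f, rfl⟩
    exact sum_mul_generator hπ f
  have hφ : φ.range = ⊤ := by
    rw [LinearMap.range_eq_top]
    intro c
    refine ⟨fun _ => c, ?_⟩
    change ∑ i, π i * c = c
    rw [← Finset.sum_mul, hπ.1.2, one_mul]
  have h1 := G.finrank_range_add_finrank_ker
  have h2 := φ.finrank_range_add_finrank_ker
  rw [hφ, finrank_top, Module.finrank_self] at h2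
  have heq := Submodule.eq_of_le_of_finrank_le hle (by omega)
  obtain ⟨f, hf⟩ : g ∈ G.range := heq ▸ (LinearMap.mem_ker.2 hg)
  exact ⟨f, fun i => congrFun hf i⟩

theorem pow_nonneg_apply {K : Matrix (Fin N) (Fin N) ℝ} (hK : ∀ i j, 0 ≤ K i j) (n : ℕ)
    (i j : Fin N) : 0 ≤ (K ^ n) i j := by
  induction n generalizing i j with
  | zero =>
    rw [pow_zero, Matrix.one_apply]
    split_ifs <;> simp
  | succ n ih =>
    rw [pow_succ, Matrix.mul_apply]
    exact Finset.sum_nonneg fun k _ => mul_nonneg (ih i k) (hK k j)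

/-- `K` serves as a graph of likely jumps. A bound on `f` follows by propagating the gap below its
maximum along a path of `K` to `j`, where `f` vanishes. -/
theorem exists_isPoissonSolution {q : Fin N → Fin N → ℝ} (hq : ∀ i j, i ≠ j → 0 < q i j)
    {π : Fin N → ℝ} (hπ : IsInvariantRates q π) {K : Matrix (Fin N) (Fin N) ℝ}
    (hK : ∀ i j, 0 ≤ K i j) {p S C τ : ℝ} (hp : 0 < p) (hp1 : p ≤ 1)
    (hstep : ∀ i k, 0 < K i k → k ≠ i ∧ p * exitRate q i ≤ q i k)
    (hexit : ∀ i, 0 < exitRate q i) (hS : ∀ i, (exitRate q i)⁻¹ ≤ S) {D : ℕ}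
    (hD : ∀ i j, ∃ n ≤ D, 0 < (K ^ n) i j) (hC : D * S ≤ p ^ D * (C * τ)) (j : Fin N) :
    ∃ f, IsPoissonSolution q j (π j) (C * π j * τ) f := by
  have hπj : 0 < π j := hπ.pos hq j
  obtain ⟨f₀, hf₀⟩ := exists_generator_eq hq hπ (g := fun i => (if i = j then 1 else 0) - π j) (by
    simp [mul_sub, ← Finset.sum_mul, hπ.1.2])
  obtain ⟨f, hfe, hfj⟩ : ∃ f : Fin N → ℝ,
      (∀ i, generator q f i = (if i = j then 1 else 0) - π j) ∧ f j = 0 := by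
    refine ⟨fun k => -f₀ j + 1 * f₀ k, fun i => ?_, by ring⟩
    rw [generator_const_add_mul, one_mul, hf₀]
  have hf0 : ∀ i, 0 ≤ f i := by
    obtain ⟨a, -, ha⟩ := Finset.exists_min_image Finset.univ f ⟨j, Finset.mem_univ j⟩
    -- Away from `j` the generator of `f` equals `-π j < 0`, which is impossible at a minimum.
    have haj : a = j := by
      by_contra hne
      have h1 := hfe a
      rw [if_neg hne] at h1
      have h2 : 0 ≤ generator q f a := Finset.sum_nonneg fun k hk =>
        mul_nonneg (hq _ _ (Finset.ne_of_mem_erase hk).symm).le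
          (sub_nonneg.2 (ha k (Finset.mem_univ k)))
      linarith
    intro i
    have := ha i (Finset.mem_univ i)
    rwa [haj, hfj] at this
  obtain ⟨b, -, hb⟩ := Finset.exists_max_image Finset.univ f ⟨j, Finset.mem_univ j⟩
  have hb' : ∀ i, f i ≤ f b := fun i => hb i (Finset.mem_univ i)
  have hS0 : 0 ≤ S := (inv_nonneg.2 (hexit j).le).trans (hS j)
  have hM0 := hf0 b
  -- At `i ≠ j` the equation says that the jump average of the gap `f b - f` is its value at `i`
  -- plus `π j / exitRate i`. Keeping a single edge `i → k` gives `p (f b - f k) ≤ f b - f i + π j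
  -- S`. At `j` the gap is all of `f b`, and taking `i = b` makes the gap on the right vanish.
  have hpath : ∀ (n : ℕ) (i : Fin N), 0 < (K ^ n) i j →
      p ^ n * f b ≤ f b - f i + n * (π j * S) := by
    intro n
    induction n with
    | zero =>
      intro i hi
      rw [pow_zero, Matrix.one_apply] at hi
      have : i = j := by by_contra h; simp [h] at hi
      rw [this, hfj]; simp
    | succ n ih =>
      intro i hi
      rw [pow_succ', Matrix.mul_apply] at hi
      obtain ⟨k, -, hk⟩ := Finset.exists_lt_of_sum_lt
        (lt_of_eq_of_lt (Finset.sum_const_zero (s := Finset.univ)) hi)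
      have hk2 : 0 < (K ^ n) k j := (pow_nonneg_apply hK n k j).lt_of_ne' fun h => by
        rw [h, mul_zero] at hk; exact lt_irrefl _ hk
      have hk1 : 0 < K i k := (hK i k).lt_of_ne' fun h => by
        rw [h, zero_mul] at hk; exact lt_irrefl _ hk
      by_cases hij : i = j
      · rw [hij, hfj]
        have h1 : p ^ (n + 1) * f b ≤ 1 * f b :=
          mul_le_mul_of_nonneg_right (pow_le_one₀ hp.le hp1) hM0
        have h2 : 0 ≤ ((n + 1 : ℕ) : ℝ) * (π j * S) := by positivity
        linarith
      · obtain ⟨hki, hqk⟩ := hstep i k hk1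
        have h1 := hfe i
        rw [if_neg hij] at h1
        have h2 : exitRate q i * (f b - f i) + π j
            = ∑ l ∈ Finset.univ.erase i, q i l * (f b - f l) := by
          have : generator q f i = exitRate q i * (f b - f i)
              - ∑ l ∈ Finset.univ.erase i, q i l * (f b - f l) := by
            simp only [generator, exitRate, Finset.sum_mul, ← Finset.sum_sub_distrib]
            exact Finset.sum_congr rfl fun l _ => by ring
          linarith
        have h3 : q i k * (f b - f k) ≤ ∑ l ∈ Finset.univ.erase i, q i l * (f b - f l) :=
          Finset.single_le_sum (f := fun l => q i l * (f b - f l)) (fun l hl =>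
            mul_nonneg (hq _ _ (Finset.ne_of_mem_erase hl).symm).le (sub_nonneg.2 (hb' l)))
            (Finset.mem_erase.2 ⟨hki, Finset.mem_univ k⟩)
        have h4 : p * exitRate q i * (f b - f k) ≤ q i k * (f b - f k) :=
          mul_le_mul_of_nonneg_right hqk (sub_nonneg.2 (hb' k))
        have h5 : p * (f b - f k) ≤ f b - f i + π j * S := by
          have h6 : exitRate q i * (p * (f b - f k))
              ≤ exitRate q i * (f b - f i + π j * (exitRate q i)⁻¹) := by
            have : exitRate q i * (f b - f i + π j * (exitRate q i)⁻¹)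
              = exitRate q i * (f b - f i) + π j := by
              have := (hexit i).ne'
              field_simp
            rw [this]; linarith
          have h7 := le_of_mul_le_mul_left h6 (hexit i)
          have h8 := mul_le_mul_of_nonneg_left (hS i) hπj.le
          linarith
        have h6 := mul_le_mul_of_nonneg_left (ih k hk2) hp.le
        have h7 : p * (n * (π j * S)) ≤ 1 * (n * (π j * S)) :=
          mul_le_mul_of_nonneg_right hp1 (by positivity)
        rw [pow_succ']
        push_cast
        linarith
  refine ⟨f, hf0, fun i => (hb' i).trans ?_, hfj, hfe⟩
  obtain ⟨n, hn, hnb⟩ := hD b j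
  have h1 := hpath n b hnb
  have h2 : p ^ D * f b ≤ p ^ n * f b :=
    mul_le_mul_of_nonneg_right (pow_le_pow_of_le_one hp.le hp1 hn) hM0
  have h3 : (n : ℝ) * (π j * S) ≤ D * (π j * S) := by gcongr
  have h4 : p ^ D * f b ≤ p ^ D * (C * π j * τ) := by
    calc p ^ D * f b ≤ π j * (D * S) := by linarith
      _ ≤ π j * (p ^ D * (C * τ)) := by gcongr
      _ = _ := by ring
  exact le_of_mul_le_mul_left h4 (by positivity)

/-! ### Invariant measures of irreducible nonnegative matrices. -/

theorem sum_mul_pow_of_invariant {K : Matrix (Fin N) (Fin N) ℝ} {v : Fin N → ℝ}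
    (hv : ∀ j, ∑ i, v i * K i j = v j) (n : ℕ) (j : Fin N) : ∑ i, v i * (K ^ n) i j = v j := by
  have h : Matrix.vecMul v K = v := funext hv
  have : Matrix.vecMul v (K ^ n) = v := by
    induction n with
    | zero => simp
    | succ n ih => rw [pow_succ, ← Matrix.vecMul_vecMul, ih, h]
  exact congrFun this j

theorem eq_zero_of_invariant_of_apply_eq_zero {K : Matrix (Fin N) (Fin N) ℝ}
    (hK : ∀ i j, 0 ≤ K i j) (hirr : ∀ i j, Reaches K i j) {v : Fin N → ℝ} (hv0 : ∀ i, 0 ≤ v i)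
    (hv : ∀ j, ∑ i, v i * K i j = v j) {j : Fin N} (hj : v j = 0) (i : Fin N) : v i = 0 := by
  obtain ⟨n, hn⟩ := hirr i j
  have h1 := sum_mul_pow_of_invariant hv n j
  rw [hj, Finset.sum_eq_zero_iff_of_nonneg fun k _ =>
    mul_nonneg (hv0 k) (pow_nonneg_apply hK n k j)] at h1
  exact (mul_eq_zero.1 (h1 i (Finset.mem_univ i))).resolve_right hn.ne'

theorem IsInvariantMatrix.pos {K : Matrix (Fin N) (Fin N) ℝ} (hK : ∀ i j, 0 ≤ K i j)
    (hirr : ∀ i j, Reaches K i j) {π : Fin N → ℝ} (hπ : IsInvariantMatrix K π) (j : Fin N) :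
    0 < π j := by
  refine (hπ.1.1 j).lt_of_ne' fun h0 => ?_
  have h1 := eq_zero_of_invariant_of_apply_eq_zero hK hirr hπ.1.1 hπ.2 h0
  have h2 := hπ.1.2
  simp [h1] at h2

/-- Subtract the largest multiple `c π'` lying below `π`: the difference is nonnegative, invariant
and vanishes somewhere, hence everywhere by irreducibility. Total mass gives `c = 1`. -/
theorem IsInvariantMatrix.unique {K : Matrix (Fin N) (Fin N) ℝ} (hK : ∀ i j, 0 ≤ K i j)
    (hirr : ∀ i j, Reaches K i j) {π π' : Fin N → ℝ} (hπ : IsInvariantMatrix K π)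
    (hπ' : IsInvariantMatrix K π') : π = π' := by
  have hpos' := hπ'.pos hK hirr
  rcases isEmpty_or_nonempty (Fin N) with h | ⟨⟨i₀⟩⟩
  · exact Subsingleton.elim _ _
  obtain ⟨a, -, ha⟩ := Finset.exists_min_image Finset.univ (fun i => π i / π' i)
    ⟨i₀, Finset.mem_univ i₀⟩
  set c := π a / π' a with hc
  have h0 : ∀ i, π i - c * π' i = 0 := by
    refine eq_zero_of_invariant_of_apply_eq_zero hK hirr (v := fun i => π i - c * π' i) (j := a)
      (fun i => ?_) (fun j => ?_) ?_
    · have := ha i (Finset.mem_univ i)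
      rw [le_div_iff₀ (hpos' i)] at this
      linarith
    · simp only [sub_mul, Finset.sum_sub_distrib, mul_assoc, ← Finset.mul_sum, hπ.2, hπ'.2]
    · simp only [hc]
      rw [div_mul_cancel₀ _ (hpos' a).ne', sub_self]
  have hsum : ∑ i, (π i - c * π' i) = 0 := Finset.sum_eq_zero fun i _ => h0 i
  rw [Finset.sum_sub_distrib, ← Finset.mul_sum, hπ.1.2, hπ'.1.2] at hsum
  have hc1 : c = 1 := by linarith
  funext i
  have := h0 i
  rw [hc1] at this
  linarith

/-! ### Limits of rate ratios, of the embedded chain and of the invariant measure. -/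

theorem exists_tendsto_of_tendsto_ofReal {l : Filter ℝ} [l.NeBot] {f : ℝ → ℝ} {L : ℝ≥0∞} {C : ℝ}
    (h0 : ∀ᶠ ε in l, 0 ≤ f ε) (hC : ∀ᶠ ε in l, f ε ≤ C)
    (hf : Tendsto (fun ε => ENNReal.ofReal (f ε)) l (𝓝 L)) : ∃ x, Tendsto f l (𝓝 x) := by
  have hL : L ≤ ENNReal.ofReal C :=
    le_of_tendsto hf (hC.mono fun ε h => ENNReal.ofReal_le_ofReal h)
  refine ⟨L.toReal, ((ENNReal.tendsto_toReal (ne_top_of_le_ne_top ENNReal.ofReal_ne_top hL)).comp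
    hf).congr' (h0.mono fun ε h => ENNReal.toReal_ofReal h)⟩

theorem exitTime_pos (hN : 2 ≤ N) {q : ℝ → Fin N → Fin N → ℝ} (hq : AsympRegular q) {ε : ℝ}
    (hε : 0 < ε) (i : Fin N) : 0 < exitTime q i ε :=
  inv_pos.2 (exitRate_pos hN (hq.pos ε hε) i)

theorem isInvariantRates_invMeasure (hN : 2 ≤ N) {q : ℝ → Fin N → Fin N → ℝ}
    (hq : AsympRegular q) {ε : ℝ} (hε : 0 < ε) : IsInvariantRates (q ε) (invMeasure q ε) :=
  Classical.epsilon_spec (exists_isInvariantRates (by omega) (hq.pos ε hε))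

/-- Ratio of a total exit rate to a single rate. -/
theorem AsympRegular.tendsto_exitRate_div {q : ℝ → Fin N → Fin N → ℝ} (hq : AsympRegular q)
    (k : Fin N) {i j : Fin N} (hij : i ≠ j) :
    ∃ L : ℝ≥0∞, Tendsto (fun ε => ENNReal.ofReal (exitRate (q ε) k / q ε i j)) (𝓝[>] 0) (𝓝 L) := by
  -- The limit attached to the excluded index `m = k` is the dummy `0`; it never enters the sum.
  have h : ∀ m : Fin N, ∃ L : ℝ≥0∞, m ≠ k →
      Tendsto (fun ε => ENNReal.ofReal (q ε k m / q ε i j)) (𝓝[>] 0) (𝓝 L) := by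
    intro m
    by_cases hm : m = k
    · exact ⟨0, fun h => absurd hm h⟩
    · obtain ⟨L, hL⟩ := hq.ratio k m i j (Ne.symm hm) hij
      exact ⟨L, fun _ => hL⟩
  choose L hL using h
  refine ⟨∑ m ∈ Finset.univ.erase k, L m, (tendsto_finsetSum _ fun m hm =>
    hL m (Finset.ne_of_mem_erase hm)).congr' ?_⟩
  filter_upwards [self_mem_nhdsWithin] with ε (hε : 0 < ε)
  rw [exitRate, Finset.sum_div, ENNReal.ofReal_sum_of_nonneg fun m hm =>
    (div_pos (hq.pos ε hε _ _ (Finset.ne_of_mem_erase hm).symm) (hq.pos ε hε _ _ hij)).le]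

theorem AsympRegular.tendsto_div_exitRate (hN : 2 ≤ N) {q : ℝ → Fin N → Fin N → ℝ}
    (hq : AsympRegular q) (k : Fin N) {i j : Fin N} (hij : i ≠ j) :
    ∃ L : ℝ≥0∞, Tendsto (fun ε => ENNReal.ofReal (q ε i j / exitRate (q ε) k)) (𝓝[>] 0) (𝓝 L) := by
  obtain ⟨L, hL⟩ := hq.tendsto_exitRate_div k hij
  refine ⟨L⁻¹, hL.inv.congr' ?_⟩
  filter_upwards [self_mem_nhdsWithin] with ε (hε : 0 < ε)
  rw [← ENNReal.ofReal_inv_of_pos (div_pos (exitRate_pos hN (hq.pos ε hε) k)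
    (hq.pos ε hε _ _ hij)), inv_div]

theorem AsympRegular.tendsto_exitTime_div (hN : 2 ≤ N) {q : ℝ → Fin N → Fin N → ℝ}
    (hq : AsympRegular q) (k j : Fin N) :
    ∃ L : ℝ≥0∞, Tendsto (fun ε => ENNReal.ofReal (exitTime q k ε / exitTime q j ε))
      (𝓝[>] 0) (𝓝 L) := by
  have h : ∀ l : Fin N, ∃ L : ℝ≥0∞, l ≠ j →
      Tendsto (fun ε => ENNReal.ofReal (q ε j l / exitRate (q ε) k)) (𝓝[>] 0) (𝓝 L) := by
    intro l
    by_cases hl : l = j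
    · exact ⟨0, fun h => absurd hl h⟩
    · obtain ⟨L, hL⟩ := hq.tendsto_div_exitRate hN k (Ne.symm hl)
      exact ⟨L, fun _ => hL⟩
  choose L hL using h
  refine ⟨∑ m ∈ Finset.univ.erase j, L m, (tendsto_finsetSum _ fun m hm =>
    hL m (Finset.ne_of_mem_erase hm)).congr' ?_⟩
  filter_upwards [self_mem_nhdsWithin] with ε (hε : 0 < ε)
  have : exitTime q k ε / exitTime q j ε = exitRate (q ε) j / exitRate (q ε) k := by
    rw [exitTime, exitTime, inv_div_inv]
  rw [this]
  conv_rhs => rw [exitRate, Finset.sum_div]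
  rw [ENNReal.ofReal_sum_of_nonneg fun m hm =>
    (div_pos (hq.pos ε hε _ _ (Finset.ne_of_mem_erase hm).symm)
      (exitRate_pos hN (hq.pos ε hε) k)).le]

theorem div_exitRate_le_one {q : Fin N → Fin N → ℝ} (hq : ∀ i j, i ≠ j → 0 < q i j)
    {i j : Fin N} (hij : i ≠ j) : q i j / exitRate q i ≤ 1 := by
  refine div_le_one_of_le₀ ?_ (Finset.sum_nonneg fun k hk =>
    (hq _ _ (Finset.ne_of_mem_erase hk).symm).le)
  exact Finset.single_le_sum (f := fun k => q i k)
    (fun k hk => (hq _ _ (Finset.ne_of_mem_erase hk).symm).le)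
    (Finset.mem_erase.2 ⟨hij.symm, Finset.mem_univ j⟩)

theorem tendsto_skeleton (hN : 2 ≤ N) {q : ℝ → Fin N → Fin N → ℝ} (hq : AsympRegular q)
    {i j : Fin N} (hij : i ≠ j) :
    Tendsto (fun ε => q ε i j / exitRate (q ε) i) (𝓝[>] 0) (𝓝 (skeleton q i j)) := by
  rw [skeleton, if_neg (Ne.symm hij)]
  obtain ⟨L, hL⟩ := hq.tendsto_div_exitRate hN i hij
  refine tendsto_nhds_limUnder (exists_tendsto_of_tendsto_ofReal (C := 1) ?_ ?_ hL)
  · filter_upwards [self_mem_nhdsWithin] with ε (hε : 0 < ε)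
    exact (div_pos (hq.pos ε hε _ _ hij) (exitRate_pos hN (hq.pos ε hε) i)).le
  · filter_upwards [self_mem_nhdsWithin] with ε (hε : 0 < ε)
    exact div_exitRate_le_one (hq.pos ε hε) hij

theorem skeleton_nonneg (hN : 2 ≤ N) {q : ℝ → Fin N → Fin N → ℝ} (hq : AsympRegular q)
    (i j : Fin N) : 0 ≤ skeleton q i j := by
  by_cases hij : i = j
  · simp [skeleton, hij]
  · refine ge_of_tendsto (tendsto_skeleton hN hq hij) ?_
    filter_upwards [self_mem_nhdsWithin] with ε (hε : 0 < ε)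
    exact (div_pos (hq.pos ε hε _ _ hij) (exitRate_pos hN (hq.pos ε hε) i)).le

theorem Reaches.refl (K : Matrix (Fin N) (Fin N) ℝ) (i : Fin N) : Reaches K i i := ⟨0, by simp⟩

theorem Reaches.trans {K : Matrix (Fin N) (Fin N) ℝ} (hK : ∀ i j, 0 ≤ K i j) {i j k : Fin N}
    (hij : Reaches K i j) (hjk : Reaches K j k) : Reaches K i k := by
  obtain ⟨n, hn⟩ := hij
  obtain ⟨m, hm⟩ := hjk
  refine ⟨n + m, ?_⟩
  rw [pow_add, Matrix.mul_apply]
  exact Finset.sum_pos' (fun l _ => mul_nonneg (pow_nonneg_apply hK n i l)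
    (pow_nonneg_apply hK m l k)) ⟨j, Finset.mem_univ j, mul_pos hn hm⟩

/-- Without transient states reachability is symmetric, so the set reachable from any state is an
ergodic class; uniqueness identifies all these sets. -/
theorem OneErgodicClass.reaches {K : Matrix (Fin N) (Fin N) ℝ} (hK : ∀ i j, 0 ≤ K i j)
    (h : OneErgodicClass K) (i j : Fin N) : Reaches K i j := by
  obtain ⟨⟨C, -, hC⟩, htr⟩ := h
  have hback : ∀ i j, Reaches K i j → Reaches K j i := by
    intro i j hij
    by_contra hji
    exact htr i ⟨j, hij, hji⟩
  have hcl : ∀ i, IsErgodicClass K {j | Reaches K i j} := fun i =>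
    ⟨⟨i, Reaches.refl K i⟩, fun k hk j =>
      ⟨fun hkj => Reaches.trans hK hk hkj, fun hij => Reaches.trans hK (hback i k hk) hij⟩⟩
  have heq : {l | Reaches K i l} = {l | Reaches K j l} := (hC _ (hcl i)).trans (hC _ (hcl j)).symm
  have : j ∈ {l | Reaches K j l} := Reaches.refl K j
  rw [← heq] at this
  exact this

/-- The invariant measure of the embedded jump chain. -/
noncomputable def embeddedMeasure (q : ℝ → Fin N → Fin N → ℝ) (ε : ℝ) (j : Fin N) : ℝ :=
  invMeasure q ε j * exitRate (q ε) j / ∑ i, invMeasure q ε i * exitRate (q ε) i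

section Embedded

variable {q : ℝ → Fin N → Fin N → ℝ}

theorem sum_invMeasure_mul_exitRate_pos (hN : 2 ≤ N) (hq : AsympRegular q) {ε : ℝ} (hε : 0 < ε) :
    0 < ∑ i, invMeasure q ε i * exitRate (q ε) i :=
  Finset.sum_pos (fun i _ => mul_pos ((isInvariantRates_invMeasure hN hq hε).pos (hq.pos ε hε) i)
    (exitRate_pos hN (hq.pos ε hε) i)) ⟨⟨0, by omega⟩, Finset.mem_univ _⟩

theorem embeddedMeasure_pos (hN : 2 ≤ N) (hq : AsympRegular q) {ε : ℝ} (hε : 0 < ε) (j : Fin N) :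
    0 < embeddedMeasure q ε j :=
  div_pos (mul_pos ((isInvariantRates_invMeasure hN hq hε).pos (hq.pos ε hε) j)
    (exitRate_pos hN (hq.pos ε hε) j)) (sum_invMeasure_mul_exitRate_pos hN hq hε)

theorem embeddedMeasure_mem_stdSimplex (hN : 2 ≤ N) (hq : AsympRegular q) {ε : ℝ} (hε : 0 < ε) :
    embeddedMeasure q ε ∈ stdSimplex ℝ (Fin N) := by
  refine ⟨fun j => (embeddedMeasure_pos hN hq hε j).le, ?_⟩
  simp only [embeddedMeasure]
  rw [← Finset.sum_div, div_self (sum_invMeasure_mul_exitRate_pos hN hq hε).ne']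

theorem sum_embeddedMeasure_mul (hN : 2 ≤ N) (hq : AsympRegular q) {ε : ℝ} (hε : 0 < ε)
    (j : Fin N) : ∑ i ∈ Finset.univ.erase j, embeddedMeasure q ε i *
      (q ε i j / exitRate (q ε) i) = embeddedMeasure q ε j := by
  have h := (isInvariantRates_invMeasure hN hq hε).2 j
  simp only [embeddedMeasure]
  rw [← h, Finset.sum_div]
  refine Finset.sum_congr rfl fun i _ => ?_
  have := (exitRate_pos hN (hq.pos ε hε) i).ne'
  field_simp

theorem isInvariantMatrix_of_mapClusterPt (hN : 2 ≤ N) (hq : AsympRegular q) {x : Fin N → ℝ}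
    (hx : x ∈ stdSimplex ℝ (Fin N)) (hcl : MapClusterPt x (𝓝[>] 0) (embeddedMeasure q)) :
    IsInvariantMatrix (skeleton q) x := by
  refine ⟨⟨hx.1, hx.2⟩, fun j => ?_⟩
  set G : (Fin N → ℝ) → ℝ := fun v => ∑ i, v i * skeleton q i j - v j with hG
  have hGc : Continuous G := by fun_prop
  have hlim : Tendsto (fun ε => G (embeddedMeasure q ε)) (𝓝[>] 0) (𝓝 0) := by
    -- The embedded measure is exactly invariant for the jump probabilities at `ε`, so its defect
    -- for the skeleton is at most the difference of the two matrices, which vanishes in the limit.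
    have hz : ∀ i ∈ Finset.univ.erase j, Tendsto (fun ε => embeddedMeasure q ε i *
        (skeleton q i j - q ε i j / exitRate (q ε) i)) (𝓝[>] 0) (𝓝 0) := by
      intro i hi
      have h1 := ((tendsto_skeleton hN hq (Finset.ne_of_mem_erase hi)).const_sub
        (skeleton q i j)).abs
      rw [sub_self, abs_zero] at h1
      refine squeeze_zero_norm' ?_ h1
      filter_upwards [self_mem_nhdsWithin] with ε (hε : 0 < ε)
      rw [Real.norm_eq_abs, abs_mul, abs_of_pos (embeddedMeasure_pos hN hq hε i)]
      refine mul_le_of_le_one_left (abs_nonneg _) ?_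
      have hs := embeddedMeasure_mem_stdSimplex hN hq hε
      rw [← hs.2]
      exact Finset.single_le_sum (f := fun i => embeddedMeasure q ε i) (fun k _ => hs.1 k)
        (Finset.mem_univ i)
    have h2 := tendsto_finsetSum _ hz
    rw [Finset.sum_const_zero] at h2
    refine h2.congr' ?_
    filter_upwards [self_mem_nhdsWithin] with ε (hε : 0 < ε)
    simp only [mul_sub, Finset.sum_sub_distrib]
    rw [sum_embeddedMeasure_mul hN hq hε j, hG]
    simp only
    rw [← Finset.add_sum_erase _ _ (Finset.mem_univ j)]
    simp [skeleton]
  have h3 : MapClusterPt (G x) (𝓝[>] 0) (fun ε => G (embeddedMeasure q ε)) :=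
    hcl.continuousAt_comp hGc.continuousAt
  have h4 : ClusterPt (G x) (𝓝 0) := ClusterPt.mono h3 hlim
  have h5 : G x = 0 := by
    have : (𝓝 (G x) ⊓ 𝓝 0).NeBot := h4
    exact eq_of_nhds_neBot this
  linarith

/-- Existence comes from compactness of the simplex: any cluster point of the embedded measures is
invariant for the skeleton. -/
theorem isInvariantMatrix_skeletonMeasure (hN : 2 ≤ N) (hq : AsympRegular q) :
    IsInvariantMatrix (skeleton q) (skeletonMeasure q) := by
  refine Classical.epsilon_spec ?_
  obtain ⟨x, hx, hcl⟩ := (isCompact_stdSimplex ℝ (Fin N)).exists_mapClusterPt (f := 𝓝[>] (0 : ℝ))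
    (u := embeddedMeasure q) (by
      rw [Filter.le_principal_iff, Filter.mem_map]
      filter_upwards [self_mem_nhdsWithin] with ε (hε : 0 < ε)
      exact embeddedMeasure_mem_stdSimplex hN hq hε)
  exact ⟨x, isInvariantMatrix_of_mapClusterPt hN hq hx hcl⟩

theorem skeletonMeasure_pos (hN : 2 ≤ N) (hq : AsympRegular q)
    (hskel : OneErgodicClass (skeleton q)) (j : Fin N) : 0 < skeletonMeasure q j :=
  (isInvariantMatrix_skeletonMeasure hN hq).pos (skeleton_nonneg hN hq)
    (hskel.reaches (skeleton_nonneg hN hq)) j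

theorem tendsto_embeddedMeasure (hN : 2 ≤ N) (hq : AsympRegular q)
    (hskel : OneErgodicClass (skeleton q)) :
    Tendsto (embeddedMeasure q) (𝓝[>] 0) (𝓝 (skeletonMeasure q)) := by
  refine (isCompact_stdSimplex ℝ (Fin N)).tendsto_nhds_of_unique_mapClusterPt ?_
    fun x hx hcl => ?_
  · filter_upwards [self_mem_nhdsWithin] with ε (hε : 0 < ε)
    exact embeddedMeasure_mem_stdSimplex hN hq hε
  · exact (isInvariantMatrix_of_mapClusterPt hN hq hx hcl).unique (skeleton_nonneg hN hq)
      (hskel.reaches (skeleton_nonneg hN hq)) (isInvariantMatrix_skeletonMeasure hN hq)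

theorem inv_invMeasure_eq_sum (hN : 2 ≤ N) (hq : AsympRegular q) {ε : ℝ} (hε : 0 < ε)
    (j : Fin N) : (invMeasure q ε j)⁻¹ = ∑ k, embeddedMeasure q ε k / embeddedMeasure q ε j *
      (exitTime q k ε / exitTime q j ε) := by
  have hinv := isInvariantRates_invMeasure hN hq hε
  have hZ := (sum_invMeasure_mul_exitRate_pos hN hq hε).ne'
  have hj := (hinv.pos (hq.pos ε hε) j).ne'
  have hterm : ∀ k, embeddedMeasure q ε k / embeddedMeasure q ε j *
      (exitTime q k ε / exitTime q j ε) = invMeasure q ε k * (invMeasure q ε j)⁻¹ := by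
    intro k
    have h1 := (exitRate_pos hN (hq.pos ε hε) k).ne'
    have h2 := (exitRate_pos hN (hq.pos ε hε) j).ne'
    rw [embeddedMeasure, embeddedMeasure, exitTime, exitTime]
    field_simp
  simp only [hterm]
  rw [← Finset.sum_mul, hinv.1.2, one_mul]

/-- Passing to the reciprocal turns `μ(j, ε)` into a sum of nonnegative terms, each converging in
`[0, ∞]`. The weights `ν k / ν j` have finite positive limits, so no product `0 * ∞` arises. -/
theorem tendsto_invMeasure (hN : 2 ≤ N) (hq : AsympRegular q)
    (hskel : OneErgodicClass (skeleton q)) (j : Fin N) :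
    Tendsto (fun ε => invMeasure q ε j) (𝓝[>] 0) (𝓝 (limMeasure q j)) := by
  have hemb := tendsto_pi_nhds.1 (tendsto_embeddedMeasure hN hq hskel)
  have hpos := skeletonMeasure_pos hN hq hskel
  choose L hL using fun k => hq.tendsto_exitTime_div hN k j
  have hsum : Tendsto (fun ε => ∑ k, ENNReal.ofReal (embeddedMeasure q ε k / embeddedMeasure q ε j) *
      ENNReal.ofReal (exitTime q k ε / exitTime q j ε)) (𝓝[>] 0)
      (𝓝 (∑ k, ENNReal.ofReal (skeletonMeasure q k / skeletonMeasure q j) * L k)) := by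
    refine tendsto_finsetSum _ fun k _ => ENNReal.Tendsto.mul
      (ENNReal.tendsto_ofReal ((hemb k).div (hemb j) (hpos j).ne')) (Or.inl ?_) (hL k)
      (Or.inr ENNReal.ofReal_ne_top)
    exact (ENNReal.ofReal_pos.2 (div_pos (hpos k) (hpos j))).ne'
  have hlim : Tendsto (fun ε => ENNReal.ofReal (invMeasure q ε j)) (𝓝[>] 0)
      (𝓝 (∑ k, ENNReal.ofReal (skeletonMeasure q k / skeletonMeasure q j) * L k)⁻¹) := by
    refine hsum.inv.congr' ?_
    filter_upwards [self_mem_nhdsWithin] with ε (hε : 0 < ε)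
    have hμ := (isInvariantRates_invMeasure hN hq hε).pos (hq.pos ε hε) j
    rw [← inv_inv (invMeasure q ε j), ENNReal.ofReal_inv_of_pos (inv_pos.2 hμ),
      inv_invMeasure_eq_sum hN hq hε j]
    congr 1
    have hn : ∀ k, 0 ≤ embeddedMeasure q ε k / embeddedMeasure q ε j := fun k =>
      (div_pos (embeddedMeasure_pos hN hq hε k) (embeddedMeasure_pos hN hq hε j)).le
    have hn' : ∀ k, 0 ≤ exitTime q k ε / exitTime q j ε := fun k =>
      (div_pos (exitTime_pos hN hq hε k) (exitTime_pos hN hq hε j)).le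
    rw [ENNReal.ofReal_sum_of_nonneg fun k _ => mul_nonneg (hn k) (hn' k)]
    exact Finset.sum_congr rfl fun k _ => (ENNReal.ofReal_mul (hn k)).symm
  refine tendsto_nhds_limUnder (exists_tendsto_of_tendsto_ofReal (C := 1) ?_ ?_ hlim)
  · filter_upwards [self_mem_nhdsWithin] with ε (hε : 0 < ε)
    exact (isInvariantRates_invMeasure hN hq hε).1.1 j
  · filter_upwards [self_mem_nhdsWithin] with ε (hε : 0 < ε)
    have hs := (isInvariantRates_invMeasure hN hq hε).1
    rw [← hs.2]
    exact Finset.single_le_sum (f := fun i => invMeasure q ε i) (fun k _ => hs.1 k)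
      (Finset.mem_univ j)

end Embedded

/-! ### Estimates uniform in `ε`. -/

theorem exists_pos_forall_le {ι : Type*} [Finite ι] (g : ι → ℝ) (hg : ∀ i, 0 < g i) :
    ∃ l, 0 < l ∧ ∀ i, l ≤ g i := by
  rcases isEmpty_or_nonempty ι with h | h
  · exact ⟨1, one_pos, fun i => h.elim i⟩
  · obtain ⟨a, ha⟩ := Finite.exists_min g
    exact ⟨g a, hg a, ha⟩

theorem meanStepTime_pos (hN : 2 ≤ N) {q : ℝ → Fin N → Fin N → ℝ} (hq : AsympRegular q)
    (hskel : OneErgodicClass (skeleton q)) {ε : ℝ} (hε : 0 < ε) : 0 < meanStepTime q ε :=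
  Finset.sum_pos (fun i _ => mul_pos (skeletonMeasure_pos hN hq hskel i)
    (exitTime_pos hN hq hε i)) ⟨⟨0, by omega⟩, Finset.mem_univ _⟩

/-- `T̄` is a weighted average of the exit times, hence at most the largest. The state found may
depend on `ε`. -/
theorem exists_exitRate_mul_meanStepTime_le (hN : 2 ≤ N) {q : ℝ → Fin N → Fin N → ℝ}
    (hq : AsympRegular q) {ε : ℝ} (hε : 0 < ε) :
    ∃ j, exitRate (q ε) j * meanStepTime q ε ≤ 1 := by
  obtain ⟨a, -, ha⟩ := Finset.exists_max_image Finset.univ (fun i => exitTime q i ε)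
    ⟨(⟨0, by omega⟩ : Fin N), Finset.mem_univ _⟩
  refine ⟨a, ?_⟩
  have hw := (isInvariantMatrix_skeletonMeasure hN hq).1
  have h1 : meanStepTime q ε ≤ exitTime q a ε := by
    calc meanStepTime q ε ≤ ∑ i, skeletonMeasure q i * exitTime q a ε :=
          Finset.sum_le_sum fun i hi => mul_le_mul_of_nonneg_left (ha i hi) (hw.1 i)
      _ = exitTime q a ε := by rw [← Finset.sum_mul, hw.2, one_mul]
  have h2 := exitRate_pos hN (hq.pos ε hε) a
  calc _ ≤ exitRate (q ε) a * exitTime q a ε := by gcongr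
    _ = 1 := mul_inv_cancel₀ h2.ne'

/-- The Poisson equations have solutions of order `meanStepTime`, uniformly for small `ε`. -/
theorem exists_eventually_isPoissonSolution (hN : 2 ≤ N) {q : ℝ → Fin N → Fin N → ℝ}
    (hq : AsympRegular q) (hskel : OneErgodicClass (skeleton q)) :
    ∃ C : ℝ, 0 < C ∧ ∀ᶠ ε in 𝓝[>] 0, ∀ j, ∃ f, IsPoissonSolution (q ε) j (invMeasure q ε j)
      (C * invMeasure q ε j * meanStepTime q ε) f := by
  have hK := skeleton_nonneg hN hq
  have hpos := skeletonMeasure_pos hN hq hskel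
  obtain ⟨l, hl, hlw⟩ := exists_pos_forall_le _ hpos
  -- Vanishing skeleton entries are replaced by `1`, so `p₀` bounds the positive ones from below.
  -- Halving it next makes the bound strict, hence valid for the true jump probabilities at small
  -- `ε`.
  obtain ⟨p₀, hp₀, hp₀K⟩ := exists_pos_forall_le
    (fun x : Fin N × Fin N => if 0 < skeleton q x.1 x.2 then skeleton q x.1 x.2 else 1)
    (fun x => by by_cases h : 0 < skeleton q x.1 x.2 <;> simp [h])
  set p := min (p₀ / 2) 1 with hpdef
  have hp : 0 < p := lt_min (by linarith) one_pos
  have hstep : ∀ᶠ ε in 𝓝[>] 0, ∀ i k, 0 < skeleton q i k →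
      k ≠ i ∧ p * exitRate (q ε) i ≤ q ε i k := by
    refine eventually_all.2 fun i => eventually_all.2 fun k => ?_
    by_cases h : 0 < skeleton q i k
    · have hki : k ≠ i := by
        rintro rfl
        simp [skeleton] at h
      have hlt : p < skeleton q i k := by
        have := hp₀K (i, k)
        simp only [h, if_true] at this
        have := min_le_left (p₀ / 2) 1
        linarith
      filter_upwards [(tendsto_skeleton hN hq hki.symm).eventually_const_lt hlt,
        self_mem_nhdsWithin] with ε h1 (hε : 0 < ε) _
      rw [lt_div_iff₀ (exitRate_pos hN (hq.pos ε hε) i)] at h1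
      exact ⟨hki, h1.le⟩
    · exact Eventually.of_forall fun _ h' => absurd h' h
  choose n hn using hskel.reaches hK
  set D := Finset.univ.sup fun x : Fin N × Fin N => n x.1 x.2 with hDdef
  have hD : ∀ i j, ∃ m ≤ D, 0 < (skeleton q ^ m) i j := fun i j =>
    ⟨n i j, Finset.le_sup (f := fun x : Fin N × Fin N => n x.1 x.2) (Finset.mem_univ (i, j)),
      hn i j⟩
  -- Exit times are at most `T̄ / l` because every `λ i ≥ l`. Using `D + 1` in place of `D` makes
  -- positivity of the constant immediate.
  refine ⟨(D + 1) / (l * p ^ D), by positivity, ?_⟩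
  filter_upwards [hstep, self_mem_nhdsWithin] with ε h1 (hε : 0 < ε) j
  have hT := meanStepTime_pos hN hq hskel hε
  refine exists_isPoissonSolution (hq.pos ε hε) (isInvariantRates_invMeasure hN hq hε) hK hp
    (min_le_right _ _) h1 (exitRate_pos hN (hq.pos ε hε)) (S := meanStepTime q ε / l)
    (fun i => ?_) hD ?_ j
  · rw [le_div_iff₀ hl]
    calc (exitRate (q ε) i)⁻¹ * l ≤ exitTime q i ε * skeletonMeasure q i :=
          mul_le_mul_of_nonneg_left (hlw i) (exitTime_pos hN hq hε i).le
      _ = skeletonMeasure q i * exitTime q i ε := mul_comm _ _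
      _ ≤ meanStepTime q ε := Finset.single_le_sum
          (f := fun i => skeletonMeasure q i * exitTime q i ε)
          (fun k _ => (mul_pos (hpos k) (exitTime_pos hN hq hε k)).le) (Finset.mem_univ i)
  · have : p ^ D * ((D + 1) / (l * p ^ D) * meanStepTime q ε)
        = (D + 1) * (meanStepTime q ε / l) := by
      field_simp
    rw [this]
    have : 0 < meanStepTime q ε / l := by positivity
    nlinarith

end MarkovFamily

/-! ### The theorem. -/

open MarkovFamily
theorem lemma3 {N : ℕ} (hN : 2 ≤ N) (q : ℝ → Fin N → Fin N → ℝ) (hq : AsympRegular q)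
    (hskel : OneErgodicClass (skeleton q))
    {Ω : ℝ → Type*} [∀ ε, MeasurableSpace (Ω ε)]
    (P : ∀ ε, Fin N → Measure (Ω ε)) (X : ∀ ε, ℝ≥0 → Ω ε → Fin N)
    (hX : ∀ ε, 0 < ε → IsMarkovChain (q ε) (P ε) (X ε))
    (t : ℝ → ℝ≥0) (ht : ∀ ε, 0 < ε → 0 < t ε)
    (htT : meanStepTime q =o[𝓝[>] 0] (fun ε => (t ε : ℝ))) :
    (∀ j, Tendsto (fun ε => invMeasure q ε j) (𝓝[>] 0) (𝓝 (limMeasure q j))) ∧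
    (∀ i j, Tendsto (fun ε => (P ε i).real {ω | X ε (t ε) ω = j}) (𝓝[>] 0)
      (𝓝 (limMeasure q j))) ∧
    (∀ i j, (fun ε => ∫ ω, occupation (X ε) j (t ε) ω ∂(P ε i))
      ~[𝓝[>] 0] (fun ε => invMeasure q ε j)) ∧
    (∀ c : ℝ, 0 < c → ∃ δ : ℝ, 0 < δ ∧ ∃ ε₀ : ℝ, 0 < ε₀ ∧
      ∀ ε, 0 < ε → ε ≤ ε₀ → ∀ i j,
        (P ε i).real {ω | occupation (X ε) j (t ε) ω < (1 - c) * invMeasure q ε j} ≤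
            Real.exp (-δ * (t ε / meanStepTime q ε)) ∧
        (P ε i).real {ω | (1 + c) * invMeasure q ε j < occupation (X ε) j (t ε) ω} ≤
            Real.exp (-δ * (t ε / meanStepTime q ε))) := by
  obtain ⟨C, hC, hpoisson⟩ := exists_eventually_isPoissonSolution hN hq hskel
  have hμ : ∀ ε, 0 < ε → ∀ j, 0 < invMeasure q ε j := fun ε hε =>
    (isInvariantRates_invMeasure hN hq hε).pos (hq.pos ε hε)
  have hT : ∀ ε, 0 < ε → 0 < meanStepTime q ε := fun ε hε => meanStepTime_pos hN hq hskel hε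
  have htT0 : Tendsto (fun ε => meanStepTime q ε / (t ε : ℝ)) (𝓝[>] 0) (𝓝 0) :=
    htT.tendsto_div_nhds_zero
  have htop : Tendsto (fun ε => (t ε : ℝ) / meanStepTime q ε) (𝓝[>] 0) atTop := by
    have h1 : Tendsto (fun ε => meanStepTime q ε / (t ε : ℝ)) (𝓝[>] 0) (𝓝[>] 0) := by
      refine tendsto_nhdsWithin_iff.2 ⟨htT0, ?_⟩
      filter_upwards [self_mem_nhdsWithin] with ε (hε : 0 < ε)
      exact div_pos (hT ε hε) (by exact_mod_cast ht ε hε)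
    exact h1.inv_tendsto_nhdsGT_zero.congr fun ε => inv_div _ _
  have hlim := tendsto_invMeasure hN hq hskel
  refine ⟨hlim, fun i j => ?_, fun i j => ?_, fun c hc => ?_⟩
  -- The contraction constant depends on `C` alone, although `j₀` may vary with `ε`.
  · set κ := Real.exp (-(8 * C)) / (2 * (1 + C)) with hκ
    have hκ0 : 0 < κ := by positivity
    have hκ1 : κ ≤ 1 := by
      rw [hκ, div_le_one (by positivity)]
      have : Real.exp (-(8 * C)) ≤ 1 := Real.exp_le_one_iff.2 (by linarith)
      linarith
    have hpow : Tendsto (fun ε => (1 - κ) ^ ⌊(t ε : ℝ) / (4 * C * meanStepTime q ε)⌋₊)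
        (𝓝[>] 0) (𝓝 0) := by
      refine (tendsto_pow_atTop_nhds_zero_of_lt_one (by linarith) (by linarith)).comp
        (tendsto_nat_floor_atTop.comp ?_)
      refine (htop.const_mul_atTop (show 0 < 1 / (4 * C) by positivity)).congr fun ε => ?_
      rw [div_mul_div_comm, one_mul]
    have hdiff : Tendsto (fun ε => (P ε i).real {ω | X ε (t ε) ω = j} - invMeasure q ε j)
        (𝓝[>] 0) (𝓝 0) := by
      refine squeeze_zero_norm' ?_ hpow
      filter_upwards [hpoisson, self_mem_nhdsWithin] with ε h1 (hε : 0 < ε)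
      obtain ⟨j₀, hj₀⟩ := exists_exitRate_mul_meanStepTime_le hN hq hε
      obtain ⟨f, hf⟩ := h1 j₀
      exact (hX ε hε).abs_transProb_sub_le_of_poisson (isInvariantRates_invMeasure hN hq hε)
        (hμ ε hε) (fun a b hab => (hq.pos ε hε a b hab).le) hC (hT ε hε)
        (exitRate_pos hN (hq.pos ε hε) j₀) hj₀ hf (t ε) i j
    simpa using hdiff.add (hlim j)
  · refine IsLittleO.of_bound fun c hc => ?_
    have h0 : Tendsto (fun ε => C * (meanStepTime q ε / (t ε : ℝ))) (𝓝[>] 0) (𝓝 0) := by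
      simpa using htT0.const_mul C
    filter_upwards [hpoisson, self_mem_nhdsWithin, h0.eventually_le_const hc] with
      ε h1 (hε : 0 < ε) h2
    obtain ⟨f, hf⟩ := h1 j
    have hm := hμ ε hε j
    have hB : 0 < C * invMeasure q ε j * meanStepTime q ε :=
      mul_pos (mul_pos hC hm) (hT ε hε)
    refine ((hX ε hε).abs_integral_occupation_sub_le hm hB hf (ht ε hε) i).trans ?_
    rw [Real.norm_eq_abs, abs_of_pos hm]
    calc C * invMeasure q ε j * meanStepTime q ε / t ε
        = C * (meanStepTime q ε / t ε) * invMeasure q ε j := by ring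
      _ ≤ c * invMeasure q ε j := by gcongr
  -- The tail bounds are available for `c ≤ 1`; for larger `c` the events only shrink.
  · set c' := min c 1 with hc'
    have hc'0 : 0 < c' := lt_min hc one_pos
    have hc'1 : c' ≤ 1 := min_le_right _ _
    have hc'c : c' ≤ c := min_le_left _ _
    -- Half of the available rate `c' ^ 2 / (8 C)`: the other half absorbs the prefactor `2` once `δ
    -- t / T̄ ≥ log 2`.
    set δ := c' ^ 2 / (16 * C) with hδdef
    have hδ : 0 < δ := by positivity
    have hev := hpoisson.and (htop.eventually_ge_atTop (Real.log 2 / δ))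
    obtain ⟨ε₀, hε₀, hsub⟩ := mem_nhdsGT_iff_exists_Ioc_subset.1 hev
    refine ⟨δ, hδ, ε₀, hε₀, fun ε hε hεle i j => ?_⟩
    obtain ⟨h1, h2⟩ := hsub ⟨hε, hεle⟩
    obtain ⟨f, hf⟩ := h1 j
    have := (hX ε hε).isProbabilityMeasure i
    have hm := hμ ε hε j
    have hTε := hT ε hε
    have hB : 0 < C * invMeasure q ε j * meanStepTime q ε := mul_pos (mul_pos hC hm) hTε
    have hexp : 2 * Real.exp (-(c' ^ 2 * invMeasure q ε j * t ε /
          (8 * (C * invMeasure q ε j * meanStepTime q ε))))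
        ≤ Real.exp (-δ * (t ε / meanStepTime q ε)) := by
      have h3 : c' ^ 2 * invMeasure q ε j * t ε / (8 * (C * invMeasure q ε j * meanStepTime q ε))
          = 2 * (δ * (t ε / meanStepTime q ε)) := by
        rw [hδdef]; field_simp; ring
      rw [div_le_iff₀ hδ] at h2
      rw [h3, ← Real.exp_log (zero_lt_two (α := ℝ)), ← Real.exp_add, Real.exp_log zero_lt_two]
      exact Real.exp_le_exp.2 (by linarith)
    constructor
    · refine le_trans (measureReal_mono (fun ω hω => ?_))
        (((hX ε hε).measureReal_occupation_lt_le hm hB hf (ht ε hε) hc'0 hc'1 i).trans hexp)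
      rw [Set.mem_ofPred_eq] at hω ⊢
      exact hω.trans_le (mul_le_mul_of_nonneg_right (by linarith) hm.le)
    · refine le_trans (measureReal_mono (fun ω hω => ?_))
        (((hX ε hε).measureReal_occupation_gt_le hm hB hf (ht ε hε) hc'0 hc'1 i).trans hexp)
      rw [Set.mem_ofPred_eq] at hω ⊢
      exact (mul_le_mul_of_nonneg_right (by linarith) hm.le).trans_lt hω
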